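/- Let $M$ be a closed (compact, without boundary) oriented smooth surface with a Riemannian metric $h$ of constant scalar curvature $R_h\le 0$ and area form $dV$, and let $\lambda\neq 0$ be a real number. (For a non-flat $U(1)$-bundle over $M$ with Chern number $c\ne 0$ and a Yang–Mills connection with curvature $F=\lambda\,dV$, one has $\lambda=2\pi c/\int_M dV$.) For a smooth function $v$ and a smooth real one-form $b$ on $M$ put $$L\begin{pmatrix}v\\ b\end{pmatrix}=\begin{pmatrix}\Delta v+(R_h-\lambda^2)v+\lambda\langle db,dV\rangle\\ \Delta_d b-\lambda\,\mathrm{div}(v\,dV)\end{pmatrix},$$ where $\Delta=-d^*d$ is the Laplace–Beltrami operator, $\Delta_d=-(dd^*+d^*d)$ is the Hodge–de Rham Laplacian, $\langle\cdot,\cdot\rangle$ is the inner product of two-forms with $|dV|=1$, and $\mathrm{div}=-d^*$ on two-forms. Consider $L$ as an operator in the real Hilbert space $L^2(M)\oplus L^2(\Omega^1(M))$ whose domain consists of those pairs $(v,b)$ with $v,\,dv,\,b,\,db,\,d^*b\in L^2$ for which $L(v,b)$, in the sense of distributions, belongs to $L^2$; consider $\Delta_d$ in the same way as an operator in $L^2(\Omega^1(M))$,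 and call a one-form $b$ in its domain harmonic if $\Delta_d b=0$. Then: 1. $L$ is self-adjoint, and on smooth pairs it is given by the formula above; 2. the (complex) spectrum of $L$ satisfies $\sigma(L)\subset(-\infty,0]$; 3. the zero eigenspace of $L$ is exactly $\{(0,b): b \text{ harmonic}\}$; likewise, for smooth $v$ and $b$, $L(v,b)=0$ if and only if $v=0$ and $\Delta_d b=0$. -/

import Mathlib

open scoped Manifold ContDiff Bundle Topology
open Bundle MeasureTheory

/-- The model space `ℝ²` of a surface. -/
abbrev Plane := EuclideanSpace ℝ (Fin 2)

noncomputable section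
namespace Surface

set_option linter.unusedSectionVars false

/-- The standard basis of `ℝ²`. -/
abbrev e₁ : Plane := EuclideanSpace.single 0 1
abbrev e₂ : Plane := EuclideanSpace.single 1 1

section
variable (M : Type*) [TopologicalSpace M] [ChartedSpace Plane M] [IsManifold (𝓡 2) ∞ M]

/-- Smooth Riemannian metrics on `M`. -/
abbrev Metric := ContMDiffRiemannianMetric (𝓡 2) ∞ Plane (fun x : M => TangentSpace (𝓡 2) x)
/-- Smooth real one-forms `Ω¹(M)`. -/
abbrev OneForm :=
  ContMDiffSection (𝓡 2) (Plane →L[ℝ] ℝ) ∞ (fun x : M => TangentSpace (𝓡 2) x →L[ℝ] ℝ)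
instance OneForm.instAddCommGroup : AddCommGroup (OneForm M) := inferInstance
instance OneForm.instModule : Module ℝ (OneForm M) := inferInstance
instance OneForm.instMulAction : MulAction ℝ (OneForm M) := Module.toDistribMulAction.toMulAction
/-- Smooth real functions `C^∞(M)`. -/
abbrev Func := C^∞⟮𝓡 2, M; ℝ⟯
end

variable {M : Type*} [TopologicalSpace M] [ChartedSpace Plane M] [IsManifold (𝓡 2) ∞ M]

/-- The coordinate frame of the chart at `x`: `frame x q eᵢ` is the coordinate vector `∂ᵢ` of that
chart, as a tangent vector at `q`. -/
def frame (x q : M) : Plane →L[ℝ] TangentSpace (𝓡 2) q :=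
  (trivializationAt Plane (TangentSpace (𝓡 2)) x).symmL ℝ q

/-- The one-form `β` read in the chart at `x`: its coordinate expression, a covector field on `ℝ²`. -/
def pull (x : M) (β : ∀ q : M, TangentSpace (𝓡 2) q →L[ℝ] ℝ) (y : Plane) : Plane →L[ℝ] ℝ :=
  (β ((extChartAt (𝓡 2) x).symm y)).comp (frame x ((extChartAt (𝓡 2) x).symm y))

theorem frame_smooth (x : M) (u : Plane) : ContMDiffOn (𝓡 2) ((𝓡 2).prod 𝓘(ℝ, Plane)) ∞
    (fun q => TotalSpace.mk' Plane (E := TangentSpace (𝓡 2)) q (frame x q u)) (chartAt Plane x).source := by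
  have h1 := Trivialization.contMDiffOn_symmL (n := ∞) (IB := 𝓡 2) (𝕜 := ℝ)
    (trivializationAt Plane (TangentSpace (𝓡 2)) x)
  have h2 : ContMDiffOn (𝓡 2) ((𝓡 2).prod 𝓘(ℝ, Plane)) ∞
    (fun q : M => TotalSpace.mk' Plane (E := Bundle.Trivial M Plane) q u) (chartAt Plane x).source := by
    intro q hq
    rw [contMDiffWithinAt_section]
    exact contMDiffWithinAt_const
  exact h1.clm_bundle_apply h2

theorem fun_smooth_of_section {s : Set M} {f : M → ℝ} :
    ContMDiffOn (𝓡 2) ((𝓡 2).prod 𝓘(ℝ, ℝ)) ∞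
      (fun q => TotalSpace.mk' ℝ (E := Bundle.Trivial M ℝ) q (f q)) s ↔ ContMDiffOn (𝓡 2) 𝓘(ℝ) ∞ f s := by
  constructor
  · intro h q hq
    have := h q hq
    rw [contMDiffWithinAt_section] at this
    exact this
  · intro h q hq
    rw [contMDiffWithinAt_section]
    exact h q hq

theorem form_apply_frame_smooth (β : OneForm M) (x : M) (u : Plane) :
    ContMDiffOn (𝓡 2) 𝓘(ℝ) ∞ (fun q => β q (frame x q u)) (chartAt Plane x).source := by
  rw [← fun_smooth_of_section]
  exact (β.contMDiff.contMDiffOn (s := (chartAt Plane x).source)).clm_bundle_apply (frame_smooth x u)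

theorem pull_contDiffOn (β : OneForm M) (x : M) :
    ContDiffOn ℝ ∞ (pull x β) (extChartAt (𝓡 2) x).target := by
  rw [contDiffOn_clm_apply]
  intro u
  have h := (form_apply_frame_smooth β x u).comp
    (contMDiffOn_extChartAt_symm (I := 𝓡 2) (n := ∞) x)
    (fun y hy => by simpa using (extChartAt (𝓡 2) x).map_target hy)
  exact contMDiffOn_iff_contDiffOn.1 h

theorem smooth_of_frame (β : ∀ q : M, TangentSpace (𝓡 2) q →L[ℝ] ℝ)
    (h : ∀ x : M, ∀ u : Plane, ContMDiffAt (𝓡 2) 𝓘(ℝ) ∞ (fun q => β q (frame x q u)) x) :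
    ContMDiff (𝓡 2) ((𝓡 2).prod 𝓘(ℝ, Plane →L[ℝ] ℝ)) ∞
      (fun q => TotalSpace.mk' (Plane →L[ℝ] ℝ) q (β q)) := by
  intro x
  rw [contMDiffAt_hom_bundle]
  refine ⟨contMDiffAt_id, ?_⟩
  have h2 : ContMDiffAt (𝓡 2) 𝓘(ℝ, Fin 2 → ℝ) ∞
      (fun q => fun i : Fin 2 => β q (frame x q (EuclideanSpace.single i 1))) x :=
    contMDiffAt_pi_space.2 fun i => h x _
  let T : (Fin 2 → ℝ) →L[ℝ] (Plane →L[ℝ] ℝ) := LinearMap.toContinuousLinearMap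
    { toFun := fun c => ∑ i, c i • (EuclideanSpace.proj i : Plane →L[ℝ] ℝ)
      map_add' := by intro c d; simp [add_smul, Finset.sum_add_distrib]
      map_smul' := by intro r c; simp [mul_smul] }
  have h3 : ContMDiffAt (𝓡 2) 𝓘(ℝ, Plane →L[ℝ] ℝ) ∞
      (fun q => T (fun i : Fin 2 => β q (frame x q (EuclideanSpace.single i 1)))) x :=
    T.contMDiff.contMDiffAt.comp x h2
  refine h3.congr_of_eventuallyEq (Filter.Eventually.of_forall fun q => ?_)
  ext u
  have hu : u = u 0 • EuclideanSpace.single (0 : Fin 2) (1 : ℝ) +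
      u 1 • EuclideanSpace.single (1 : Fin 2) (1 : ℝ) := by
    ext i; fin_cases i <;> simp
  have : β q (frame x q u) = u 0 * β q (frame x q (EuclideanSpace.single 0 1)) +
      u 1 * β q (frame x q (EuclideanSpace.single 1 1)) := by
    conv_lhs => rw [hu]
    simp only [map_add, map_smul, smul_eq_mul]
  simp only [ContinuousLinearMap.inCoordinates]
  simp [T, Fin.sum_univ_two]
  change β q (frame x q u) = _
  rw [this]; ring

theorem frame_comp {x p q : M} (hx : q ∈ (chartAt Plane x).source)
    (hp : q ∈ (chartAt Plane p).source) (u : Plane) :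
    frame p q u = frame x q (tangentCoordChange (𝓡 2) p x q u) := by
  simp only [frame]
  rw [TangentBundle.symmL_trivializationAt_eq_core hx,
    TangentBundle.symmL_trivializationAt_eq_core hp]
  exact (tangentCoordChange_comp (I := 𝓡 2) (w := p) (x := x) (y := q) (z := q) (v := u)
    (by simp [hx, hp])).symm

theorem frame_injective {x q : M} (hx : q ∈ (chartAt Plane x).source) :
    Function.Injective (frame x q) := by
  intro u v huv
  have h := (trivializationAt Plane (TangentSpace (𝓡 2)) x).continuousLinearMapAt_symmL
    (R := ℝ) (b := q) (by simpa using hx)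
  have := congrArg ((trivializationAt Plane (TangentSpace (𝓡 2)) x).continuousLinearMapAt ℝ q) huv
  simpa only [frame, h] using this

/-- An orientation of the Riemannian surface `(M, h)`, given by its Riemannian area form `dV`: a smooth
two-form of unit length. The last field says that `dV(X, Y)` is, up to sign, the area of the
parallelogram spanned by `X` and `Y`; it forces `dV` to be alternating. -/
structure AreaForm (h : Metric M) where
  form (q : M) : TangentSpace (𝓡 2) q →L[ℝ] TangentSpace (𝓡 2) q →L[ℝ] ℝ
  contMDiff : ContMDiff (𝓡 2) ((𝓡 2).prod 𝓘(ℝ, Plane →L[ℝ] Plane →L[ℝ] ℝ)) ∞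
    (fun q => TotalSpace.mk' (Plane →L[ℝ] Plane →L[ℝ] ℝ) q (form q))
  sq_eq (q : M) (X Y : TangentSpace (𝓡 2) q) :
    form q X Y ^ 2 = h.inner q X X * h.inner q Y Y - h.inner q X Y ^ 2

namespace AreaForm
variable {h : Metric M} (dV : AreaForm h)

theorem self_eq_zero (q : M) (X : TangentSpace (𝓡 2) q) : dV.form q X X = 0 := by
  have := dV.sq_eq q X X
  have h2 : dV.form q X X ^ 2 = 0 := by rw [this]; ring
  simpa using h2

theorem form_frame_ne_zero {x q : M} (hx : q ∈ (chartAt Plane x).source) :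
    dV.form q (frame x q e₁) (frame x q e₂) ≠ 0 := by
  intro h0
  have hsq := dV.sq_eq q (frame x q e₁) (frame x q e₂)
  set X := frame x q e₁
  set Y := frame x q e₂
  have hX : X ≠ 0 := by
    intro hX
    have : e₁ = 0 := frame_injective hx (by simpa using hX)
    simpa using congrArg (fun v : Plane => v 0) this
  have hXX := h.pos q X hX
  have hZ : h.inner q X X • Y - h.inner q X Y • X ≠ 0 := by
    intro hZ
    have : h.inner q X X • e₂ - h.inner q X Y • e₁ = 0 :=
      frame_injective hx (by simpa only [map_sub, map_smul, map_zero] using hZ)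
    have := congrArg (fun v : Plane => v 1) this
    simp at this
    exact hXX.ne' this
  have hpos := h.pos q _ hZ
  have hs := h.symm q Y X
  simp only [map_sub, map_smul, sub_apply, smul_apply,
    smul_eq_mul, hs] at hpos
  rw [h0] at hsq
  nlinarith

end AreaForm

theorem alt_comp (B : Plane →ₗ[ℝ] Plane →ₗ[ℝ] ℝ) (hB : ∀ u, B u u = 0) (T : Plane →L[ℝ] Plane) :
    B (T e₁) (T e₂) = (T e₁ 0 * T e₂ 1 - T e₁ 1 * T e₂ 0) * B e₁ e₂ := by
  have key : ∀ u : Plane, u = u 0 • e₁ + u 1 • e₂ := by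
    intro u; ext i; fin_cases i <;> simp
  have h21 : B e₂ e₁ = - B e₁ e₂ := by
    have := hB (e₁ + e₂)
    simp only [map_add, LinearMap.add_apply, hB] at this
    linarith
  conv_lhs => rw [key (T e₁), key (T e₂)]
  simp only [map_add, map_smul, LinearMap.add_apply, LinearMap.smul_apply, hB,
    h21, smul_eq_mul]
  ring

theorem alternating_comp (A : Plane [⋀^Fin 2]→L[ℝ] ℝ) (T : Plane →L[ℝ] Plane) :
    A ![T e₁, T e₂] = (T e₁ 0 * T e₂ 1 - T e₁ 1 * T e₂ 0) * A ![e₁, e₂] := by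
  have u0 : ∀ a c x : Plane, Function.update ![a, c] 0 x = ![x, c] := by
    intro a c x; ext i; fin_cases i <;> simp
  have u1 : ∀ a c x : Plane, Function.update ![a, c] 1 x = ![a, x] := by
    intro a c x; ext i; fin_cases i <;> simp
  let B' : Plane →ₗ[ℝ] Plane →ₗ[ℝ] ℝ := LinearMap.mk₂ ℝ (fun u v => A ![u, v])
    (fun a b c => by have := A.map_update_add ![a, c] 0 a b; rwa [u0, u0, u0] at this)
    (fun r a c => by have := A.map_update_smul ![a, c] 0 r a; rwa [u0, u0] at this)
    (fun a b c => by have := A.map_update_add ![a, c] 1 b c; rwa [u1, u1, u1] at this)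
    (fun r a c => by have := A.map_update_smul ![a, c] 1 r c; rwa [u1, u1] at this)
  exact alt_comp B' (fun u => A.map_eq_zero_of_eq ![u, u] (i := 0) (j := 1) rfl (by decide)) T

/-- `pull x β`, as a differential form of degree one on `ℝ²`. -/
def pullForm (x : M) (β : ∀ q : M, TangentSpace (𝓡 2) q →L[ℝ] ℝ) (y : Plane) :
    Plane [⋀^Fin 1]→L[ℝ] ℝ :=
  ContinuousAlternatingMap.ofSubsingleton ℝ Plane ℝ (0 : Fin 1) (pull x β y)

theorem pullForm_apply (x : M) (β : ∀ q : M, TangentSpace (𝓡 2) q →L[ℝ] ℝ) (y : Plane)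
    (v : Fin 1 → Plane) : pullForm x β y v =
      β ((extChartAt (𝓡 2) x).symm y) (frame x ((extChartAt (𝓡 2) x).symm y) (v 0)) := rfl

theorem pullForm_contDiffOn (β : OneForm M) (x : M) :
    ContDiffOn ℝ ∞ (pullForm x β) (extChartAt (𝓡 2) x).target := by
  let T : (Plane →L[ℝ] ℝ) →L[ℝ] (Plane [⋀^Fin 1]→L[ℝ] ℝ) :=
    (ContinuousAlternatingMap.ofSubsingletonLIE (𝕜 := ℝ) (E := Plane) (F := ℝ) (0 : Fin 1)).toContinuousLinearEquiv
  exact T.contDiff.comp_contDiffOn (pull_contDiffOn β x)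

variable {h : Metric M} (dV : AreaForm h)

/-- The function `⟨dβ, dV⟩`, computed at `q` in the chart at `x`: the ratio of the two-forms `dβ` and
`dV` (recall `|dV| = 1`). -/
def curlIn (x : M) (β : ∀ q : M, TangentSpace (𝓡 2) q →L[ℝ] ℝ) (q : M) : ℝ :=
  extDeriv (pullForm x β) (extChartAt (𝓡 2) x q) ![e₁, e₂] /
    dV.form q (frame x q e₁) (frame x q e₂)

theorem curlIn_eq (β : OneForm M) {x p q : M} (hx : q ∈ (chartAt Plane x).source)
    (hp : q ∈ (chartAt Plane p).source) : curlIn dV p β q = curlIn dV x β q := by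
  set φ := extChartAt (𝓡 2) x with hφ
  set ψ := extChartAt (𝓡 2) p with hψ
  set T := tangentCoordChange (𝓡 2) p x q with hT
  have hqx : q ∈ φ.source := by simpa [φ] using hx
  have hqp : q ∈ ψ.source := by simpa [ψ] using hp
  have hτ : ∀ y ∈ ψ.target, ψ.symm y ∈ φ.source →
      fderiv ℝ (φ ∘ ψ.symm) y = tangentCoordChange (𝓡 2) p x (ψ.symm y) := by
    intro y hy hyx
    have := hasFDerivWithinAt_tangentCoordChange (I := 𝓡 2) (x := p) (y := x) (z := ψ.symm y)
      ⟨ψ.map_target hy, hyx⟩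
    rw [← hψ, ψ.right_inv hy] at this
    simp only [modelWithCornersSelf_coe, Set.range_id, hasFDerivWithinAt_univ] at this
    exact this.fderiv
  have hnhds : ∀ᶠ y in 𝓝 (ψ q), y ∈ ψ.target ∧ ψ.symm y ∈ φ.source := by
    have h1 : ψ.target ∈ 𝓝 (ψ q) := extChartAt_target_mem_nhds' (I := 𝓡 2) (ψ.map_source hqp)
    have h2 : ψ.symm ⁻¹' φ.source ∈ 𝓝 (ψ q) := by
      refine (continuousAt_extChartAt_symm' (I := 𝓡 2) hqp).preimage_mem_nhds ?_
      rw [← hψ, ψ.left_inv hqp]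
      exact extChartAt_source_mem_nhds' (I := 𝓡 2) hqx
    filter_upwards [h1, h2] with y h1 h2 using ⟨h1, h2⟩
  have hpull : pullForm p β =ᶠ[𝓝 (ψ q)] fun y =>
      (pullForm x β ((φ ∘ ψ.symm) y)).compContinuousLinearMap (fderiv ℝ (φ ∘ ψ.symm) y) := by
    filter_upwards [hnhds] with y hy
    rw [hτ y hy.1 hy.2]
    ext v
    have hsrc : ψ.symm y ∈ (chartAt Plane x).source := by
      have := hy.2
      rwa [hφ, extChartAt_source] at this
    have hsrc' : ψ.symm y ∈ (chartAt Plane p).source := by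
      have := ψ.map_target hy.1
      rwa [hψ, extChartAt_source] at this
    rw [ContinuousAlternatingMap.compContinuousLinearMap_apply, pullForm_apply, pullForm_apply,
      ← hψ, ← hφ, Function.comp_apply, φ.left_inv hy.2, frame_comp hsrc hsrc']
    rfl
  have hdiff : ContDiffAt ℝ 2 (φ ∘ ψ.symm) (ψ q) := by
    have := contDiffWithinAt_ext_coord_change (I := 𝓡 2) (n := ∞) x p (y := ψ q) (by
      rw [PartialEquiv.trans_source'', PartialEquiv.symm_symm, PartialEquiv.symm_target]
      exact Set.mem_image_of_mem _ ⟨hqp, hqx⟩)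
    simp only [modelWithCornersSelf_coe, Set.range_id, contDiffWithinAt_univ] at this
    exact this.of_le (by norm_cast)
  have hω : DifferentiableAt ℝ (pullForm x β) ((φ ∘ ψ.symm) (ψ q)) := by
    simp only [Function.comp, ψ.left_inv hqp]
    exact ((pullForm_contDiffOn β x).contDiffAt
      (extChartAt_target_mem_nhds' (I := 𝓡 2) (φ.map_source hqx))).differentiableAt (by simp)
  have hext := extDeriv_pullback hω hdiff (by simp)
  rw [← hpull.extDeriv_eq] at hext
  have hTq : fderiv ℝ (φ ∘ ψ.symm) (ψ q) = T := by
    rw [hτ _ (ψ.map_source hqp) (by rwa [ψ.left_inv hqp]), ψ.left_inv hqp]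
  rw [hTq] at hext
  have hnum : extDeriv (pullForm p β) (ψ q) ![e₁, e₂] =
      extDeriv (pullForm x β) (φ q) ![T e₁, T e₂] := by
    rw [hext]
    simp only [ContinuousAlternatingMap.compContinuousLinearMap_apply, Function.comp,
      ψ.left_inv hqp]
    congr 1
    ext i
    fin_cases i <;> simp
  have hF1 : frame p q e₁ = frame x q (T e₁) := frame_comp hx hp e₁
  have hF2 : frame p q e₂ = frame x q (T e₂) := frame_comp hx hp e₂
  have hne := dV.form_frame_ne_zero hp
  let W : Plane →ₗ[ℝ] Plane →ₗ[ℝ] ℝ :=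
    LinearMap.mk₂ ℝ (fun u v => dV.form q (frame x q u) (frame x q v))
      (fun a b c => by simp only [map_add, add_apply])
      (fun r a c => by simp only [map_smul, smul_apply])
      (fun a b c => by simp only [map_add])
      (fun r a c => by simp only [map_smul])
  have hW := alt_comp W (fun u => dV.self_eq_zero q _) T
  have hW' : dV.form q (frame x q (T e₁)) (frame x q (T e₂)) =
      (T e₁ 0 * T e₂ 1 - T e₁ 1 * T e₂ 0) * dV.form q (frame x q e₁) (frame x q e₂) := hW
  simp only [curlIn, ← hφ, ← hψ]
  rw [hF1, hF2] at hne
  rw [hnum, alternating_comp, hF1, hF2, hW']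
  rw [hW'] at hne
  exact mul_div_mul_left _ _ (left_ne_zero_of_mul hne)

theorem form_frames_smooth (B : ∀ q : M, TangentSpace (𝓡 2) q →L[ℝ] TangentSpace (𝓡 2) q →L[ℝ] ℝ)
    (hB : ContMDiff (𝓡 2) ((𝓡 2).prod 𝓘(ℝ, Plane →L[ℝ] Plane →L[ℝ] ℝ)) ∞
      (fun q => TotalSpace.mk' (Plane →L[ℝ] Plane →L[ℝ] ℝ) q (B q))) (x : M) (u v : Plane) :
    ContMDiffOn (𝓡 2) 𝓘(ℝ) ∞ (fun q => B q (frame x q u) (frame x q v))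
      (chartAt Plane x).source := by
  rw [← fun_smooth_of_section]
  exact (hB.contMDiffOn (s := (chartAt Plane x).source)).clm_bundle_apply₂
    (F₁ := Plane) (F₂ := Plane) (frame_smooth x u) (frame_smooth x v)

theorem curlIn_smooth (β : OneForm M) (x : M) :
    ContMDiffOn (𝓡 2) 𝓘(ℝ) ∞ (curlIn dV x β) (chartAt Plane x).source := by
  have h1 : ContDiffOn ℝ ∞ (fun y => extDeriv (pullForm x β) y ![e₁, e₂])
      (extChartAt (𝓡 2) x).target := by
    have hf := (pullForm_contDiffOn β x).fderiv_of_isOpen (m := ∞)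
      (isOpen_extChartAt_target (I := 𝓡 2) x) (by simp)
    have := ((ContinuousAlternatingMap.apply ℝ Plane ℝ ![e₁, e₂]).comp
      (ContinuousAlternatingMap.alternatizeUncurryFinCLM ℝ Plane ℝ)).contDiff.comp_contDiffOn hf
    exact this
  have h2 := h1.contMDiffOn.comp (contMDiffOn_extChartAt (I := 𝓡 2) (n := ∞) (x := x))
    (fun q hq => (extChartAt (𝓡 2) x).map_source (by simpa using hq))
  exact h2.div₀ (form_frames_smooth dV.form dV.contMDiff x e₁ e₂)
    (fun q hq => dV.form_frame_ne_zero hq)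

theorem curlIn_add (q : M) (β γ : OneForm M) :
    curlIn dV q (β + γ : OneForm M) q = curlIn dV q β q + curlIn dV q γ q := by
  have hd : ∀ β : OneForm M, DifferentiableAt ℝ (pullForm q β) (extChartAt (𝓡 2) q q) :=
    fun β => ((pullForm_contDiffOn β q).contDiffAt
      (extChartAt_target_mem_nhds (I := 𝓡 2) q)).differentiableAt (by simp)
  have hadd : pullForm q (β + γ : OneForm M) = pullForm q β + pullForm q γ := by
    ext y v
    rfl
  rw [curlIn, hadd, extDeriv_add (hd β) (hd γ), ContinuousAlternatingMap.add_apply, add_div]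
  rfl

theorem curlIn_smul (q : M) (r : ℝ) (β : OneForm M) :
    curlIn dV q (r • β : OneForm M) q = r * curlIn dV q β q := by
  have hadd : pullForm q (r • β : OneForm M) = r • pullForm q β := by
    ext y v
    rfl
  rw [curlIn, hadd, extDeriv_smul, ContinuousAlternatingMap.smul_apply, smul_eq_mul, mul_div_assoc]
  rfl

/-- The function `⟨dβ, dV⟩`, so that `dβ = ⟨dβ, dV⟩ dV`. -/
def curl : OneForm M →ₗ[ℝ] Func M where
  toFun β := ⟨fun q => curlIn dV q β q, by
    intro x
    have h1 := (curlIn_smooth dV β x).contMDiffAt ((chartAt Plane x).open_source.mem_nhds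
      (mem_chart_source Plane x))
    refine h1.congr_of_eventuallyEq ?_
    filter_upwards [(chartAt Plane x).open_source.mem_nhds (mem_chart_source Plane x)] with q hq
    exact curlIn_eq dV β hq (mem_chart_source Plane q)⟩
  map_add' β γ := by
    ext q
    exact curlIn_add dV q β γ
  map_smul' r β := by
    ext q
    exact curlIn_smul dV q r β

/-- The differential `df` of a function. -/
def diff : Func M →ₗ[ℝ] OneForm M where
  toFun f := ⟨fun q => mfderiv (𝓡 2) 𝓘(ℝ) f q, smooth_of_frame _ fun x u => by
    have h1 := (f.contMDiff x).mfderiv_const (m := ∞) (by simp)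
    have h2 : ContMDiffAt (𝓡 2) 𝓘(ℝ) ∞ (fun q => inTangentCoordinates (𝓡 2) 𝓘(ℝ) id f
      (mfderiv (𝓡 2) 𝓘(ℝ) f) x q u) x := h1.clm_apply contMDiffAt_const
    refine h2.congr_of_eventuallyEq (Filter.Eventually.of_forall fun q => ?_)
    simp [inTangentCoordinates, ContinuousLinearMap.inCoordinates, frame]
    rfl⟩
  map_add' f g := by
    ext q : 1
    exact mfderiv_add (f.contMDiff.mdifferentiable (by simp) q)
      (g.contMDiff.mdifferentiable (by simp) q)
  map_smul' r f := by
    ext q : 1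
    exact const_smul_mfderiv (f.contMDiff.mdifferentiable (by simp) q) r

theorem exists_frame {x q : M} (hx : q ∈ (chartAt Plane x).source) (X : TangentSpace (𝓡 2) q) :
    ∃ a b : ℝ, X = a • frame x q e₁ + b • frame x q e₂ := by
  have h := (trivializationAt Plane (TangentSpace (𝓡 2)) x).symmL_continuousLinearMapAt
    (R := ℝ) (b := q) (by simpa using hx) X
  set u : Plane := (trivializationAt Plane (TangentSpace (𝓡 2)) x).continuousLinearMapAt ℝ q X
  refine ⟨u 0, u 1, ?_⟩
  have hu : u = u 0 • e₁ + u 1 • e₂ := by ext i; fin_cases i <;> simp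
  have : frame x q u = X := h
  rw [← this]
  conv_lhs => rw [hu]
  rw [map_add, map_smul, map_smul]

/-- Cramer's rule for the vector dual to `b`. -/
def cramer (h : Metric M) (q : M) (X Y : TangentSpace (𝓡 2) q) (b : TangentSpace (𝓡 2) q →L[ℝ] ℝ) :
    TangentSpace (𝓡 2) q :=
  ((b X * h.inner q Y Y - b Y * h.inner q X Y) /
    (h.inner q X X * h.inner q Y Y - h.inner q X Y ^ 2)) • X +
  ((b Y * h.inner q X X - b X * h.inner q X Y) /
    (h.inner q X X * h.inner q Y Y - h.inner q X Y ^ 2)) • Y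


theorem gram_pos (h : Metric M) {x q : M} (hx : q ∈ (chartAt Plane x).source) :
    0 < h.inner q (frame x q e₁) (frame x q e₁) * h.inner q (frame x q e₂) (frame x q e₂) -
      h.inner q (frame x q e₁) (frame x q e₂) ^ 2 := by
  set X := frame x q e₁
  set Y := frame x q e₂
  have hX : X ≠ 0 := by
    intro hX
    have : e₁ = 0 := frame_injective hx (by simpa using hX)
    simpa using congrArg (fun v : Plane => v 0) this
  have hXX := h.pos q X hX
  have hZ : h.inner q X X • Y - h.inner q X Y • X ≠ 0 := by
    intro hZ
    have : h.inner q X X • e₂ - h.inner q X Y • e₁ = 0 :=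
      frame_injective hx (by simpa only [map_sub, map_smul, map_zero] using hZ)
    have := congrArg (fun v : Plane => v 1) this
    simp at this
    exact hXX.ne' this
  have hpos := h.pos q _ hZ
  have hs := h.symm q Y X
  simp only [map_sub, map_smul, sub_apply, smul_apply, smul_eq_mul, hs] at hpos
  have : 0 < h.inner q X X *
      (h.inner q X X * h.inner q Y Y - h.inner q X Y ^ 2) := by nlinarith
  exact pos_of_mul_pos_right this hXX.le

theorem cramer_spec (h : Metric M) {x q : M} (hx : q ∈ (chartAt Plane x).source)
    (b : TangentSpace (𝓡 2) q →L[ℝ] ℝ) :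
    h.inner q (cramer h q (frame x q e₁) (frame x q e₂) b) = b := by
  have hD := (gram_pos h hx).ne'
  ext Z
  obtain ⟨s, t, rfl⟩ := exists_frame hx Z
  have hs := h.symm q (frame x q e₂) (frame x q e₁)
  simp only [cramer, map_add, map_smul, add_apply, smul_apply, smul_eq_mul, hs]
  generalize h.inner q (frame x q e₁) (frame x q e₁) = A at *
  generalize h.inner q (frame x q e₂) (frame x q e₂) = B at *
  generalize h.inner q (frame x q e₁) (frame x q e₂) = C at *
  have hD' : B * A - C ^ 2 ≠ 0 := by rwa [mul_comm]
  field_simp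
  ring

theorem inner_injective (h : Metric M) (q : M) {X Y : TangentSpace (𝓡 2) q}
    (hXY : h.inner q X = h.inner q Y) : X = Y := by
  by_contra hne
  have := h.pos q (X - Y) (sub_ne_zero.2 hne)
  have h0 : h.inner q (X - Y) = 0 := by rw [map_sub, hXY, sub_self]
  rw [h0] at this
  simp at this

theorem exists_sharp (h : Metric M) (q : M) (b : TangentSpace (𝓡 2) q →L[ℝ] ℝ) :
    ∃ X, h.inner q X = b :=
  ⟨_, cramer_spec h (mem_chart_source Plane q) b⟩

/-- The vector `b♯` metrically dual to the covector `b`: `h(b♯, ·) = b`. -/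
def sharp (h : Metric M) (q : M) (b : TangentSpace (𝓡 2) q →L[ℝ] ℝ) : TangentSpace (𝓡 2) q :=
  Classical.choose (exists_sharp h q b)

theorem inner_sharp (h : Metric M) (q : M) (b : TangentSpace (𝓡 2) q →L[ℝ] ℝ) :
    h.inner q (sharp h q b) = b :=
  Classical.choose_spec (exists_sharp h q b)

theorem sharp_add (h : Metric M) (q : M) (b c : TangentSpace (𝓡 2) q →L[ℝ] ℝ) :
    sharp h q (b + c) = sharp h q b + sharp h q c :=
  inner_injective h q (by rw [map_add, inner_sharp, inner_sharp, inner_sharp])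

theorem sharp_smul (h : Metric M) (q : M) (r : ℝ) (b : TangentSpace (𝓡 2) q →L[ℝ] ℝ) :
    sharp h q (r • b) = r • sharp h q b :=
  inner_injective h q (by rw [map_smul, inner_sharp, inner_sharp])

theorem sharp_eq_cramer (h : Metric M) {x q : M} (hx : q ∈ (chartAt Plane x).source)
    (b : TangentSpace (𝓡 2) q →L[ℝ] ℝ) :
    sharp h q b = cramer h q (frame x q e₁) (frame x q e₂) b :=
  inner_injective h q (by rw [inner_sharp, cramer_spec h hx])

theorem sharp_frame (h : Metric M) (b : OneForm M) (x : M) : ∃ s t : M → ℝ,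
    ContMDiffAt (𝓡 2) 𝓘(ℝ) ∞ s x ∧ ContMDiffAt (𝓡 2) 𝓘(ℝ) ∞ t x ∧
    ∀ q ∈ (chartAt Plane x).source, sharp h q (b q) = s q • frame x q e₁ + t q • frame x q e₂ := by
  have hx := mem_chart_source Plane x
  have hn := (chartAt Plane x).open_source.mem_nhds hx
  have hb := fun u => (form_apply_frame_smooth b x u).contMDiffAt hn
  have hg := fun u v => (form_frames_smooth h.inner h.contMDiff x u v).contMDiffAt hn
  have hD := (gram_pos h hx).ne'
  refine ⟨_, _, ?_, ?_, fun q hq => sharp_eq_cramer h hq (b q)⟩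
  · exact (((hb e₁).mul (hg e₂ e₂)).sub ((hb e₂).mul (hg e₁ e₂))).div₀
      (((hg e₁ e₁).mul (hg e₂ e₂)).sub ((hg e₁ e₂).pow 2)) hD
  · exact (((hb e₂).mul (hg e₁ e₁)).sub ((hb e₁).mul (hg e₁ e₂))).div₀
      (((hg e₁ e₁).mul (hg e₂ e₂)).sub ((hg e₁ e₂).pow 2)) hD

/-- The Hodge star on one-forms: `⋆b = dV(b♯, ·)`; in the Euclidean plane `⋆dx = dy`, `⋆dy = -dx`. -/
def hodgeStar : OneForm M →ₗ[ℝ] OneForm M where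
  toFun b := ⟨fun q => dV.form q (sharp h q (b q)), smooth_of_frame _ fun x u => by
    obtain ⟨s, t, hs, ht, hst⟩ := sharp_frame h b x
    have hn := (chartAt Plane x).open_source.mem_nhds (mem_chart_source Plane x)
    have hg := fun v => (form_frames_smooth dV.form dV.contMDiff x v u).contMDiffAt hn
    refine ((hs.mul (hg e₁)).add (ht.mul (hg e₂))).congr_of_eventuallyEq ?_
    filter_upwards [hn] with q hq
    rw [hst q hq]
    simp only [map_add, map_smul, add_apply, smul_apply, smul_eq_mul]
    rfl⟩
  map_add' b c := by
    ext q : 1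
    exact (congrArg (dV.form q) (sharp_add h q (b q) (c q))).trans (map_add _ _ _)
  map_smul' r b := by
    ext q : 1
    exact (congrArg (dV.form q) (sharp_smul h q r (b q))).trans (map_smul _ _ _)

/-- The pointwise inner product `⟨b, c⟩ = h(b♯, c♯) = c(b♯)` of one-forms. -/
def formInner (h : Metric M) (b c : OneForm M) : Func M :=
  ⟨fun q => c q (sharp h q (b q)), by
    intro x
    obtain ⟨s, t, hs, ht, hst⟩ := sharp_frame h b x
    have hn := (chartAt Plane x).open_source.mem_nhds (mem_chart_source Plane x)
    have hg := fun v => (form_apply_frame_smooth c x v).contMDiffAt hn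
    refine ((hs.mul (hg e₁)).add (ht.mul (hg e₂))).congr_of_eventuallyEq ?_
    filter_upwards [hn] with q hq
    rw [hst q hq]
    simp only [map_add, map_smul, smul_eq_mul]
    rfl⟩

theorem formInner_comm (h : Metric M) (b c : OneForm M) (q : M) :
    formInner h b c q = formInner h c b q := by
  have h1 := DFunLike.congr_fun (inner_sharp h q (b q)) (sharp h q (c q))
  have h2 := DFunLike.congr_fun (inner_sharp h q (c q)) (sharp h q (b q))
  exact h2.symm.trans ((h.symm q _ _).trans h1)

theorem formInner_self_nonneg (h : Metric M) (b : OneForm M) (q : M) : 0 ≤ formInner h b b q := by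
  have h1 := DFunLike.congr_fun (inner_sharp h q (b q)) (sharp h q (b q))
  refine le_of_le_of_eq ?_ h1
  by_cases h0 : sharp h q (b q) = 0
  · rw [h0]; simp
  · exact (h.pos q _ h0).le

theorem formInner_add (h : Metric M) (b c e : OneForm M) (q : M) :
    formInner h (b + c) e q = formInner h b e q + formInner h c e q :=
  (congrArg (e q) (sharp_add h q (b q) (c q))).trans (map_add _ _ _)

theorem formInner_smul (h : Metric M) (r : ℝ) (b e : OneForm M) (q : M) :
    formInner h (r • b) e q = r * formInner h b e q :=
  (congrArg (e q) (sharp_smul h q r (b q))).trans (map_smul _ _ _)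

section Measure
variable [CompactSpace M] [T2Space M] [MeasurableSpace M] [BorelSpace M]

/-- The area density `√(det (hᵢⱼ))` of the metric in the chart at `x`. -/
def areaDensity (h : Metric M) (x q : M) : ℝ :=
  √(h.inner q (frame x q e₁) (frame x q e₁) * h.inner q (frame x q e₂) (frame x q e₂) -
      h.inner q (frame x q e₁) (frame x q e₂) ^ 2)

/-- The Riemannian area measure on the domain of the chart at `x`: the image of `√(det (hᵢⱼ)) dy`. -/
def chartArea (h : Metric M) (x : M) : Measure M :=
  (((volume : Measure Plane).restrict (extChartAt (𝓡 2) x).target).withDensity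
    fun y => ENNReal.ofReal (areaDensity h x ((extChartAt (𝓡 2) x).symm y))).map
      (extChartAt (𝓡 2) x).symm

/-- A smooth partition of unity subordinate to the charts. -/
def chartPartition (M : Type*) [TopologicalSpace M] [ChartedSpace Plane M] [IsManifold (𝓡 2) ∞ M]
    [CompactSpace M] [T2Space M] : SmoothPartitionOfUnity M (𝓡 2) M Set.univ :=
  Classical.choose (SmoothPartitionOfUnity.exists_isSubordinate_chartAt_source (𝓡 2) M)

theorem chartPartition_subordinate (M : Type*) [TopologicalSpace M] [ChartedSpace Plane M]
    [IsManifold (𝓡 2) ∞ M] [CompactSpace M] [T2Space M] :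
    (chartPartition M).IsSubordinate fun x => (chartAt Plane x).source :=
  Classical.choose_spec (SmoothPartitionOfUnity.exists_isSubordinate_chartAt_source (𝓡 2) M)

/-- The Riemannian area measure of `(M, h)`, glued from the charts by a partition of unity. -/
def area (h : Metric M) : Measure M :=
  Measure.sum fun x : M => (chartArea h x).withDensity
    fun q => ENNReal.ofReal (chartPartition M x q)

theorem areaDensity_continuousOn (h : Metric M) (x : M) :
    ContinuousOn (areaDensity h x) (chartAt Plane x).source := by
  have hg := fun u v => (form_frames_smooth h.inner h.contMDiff x u v).continuousOn
  exact (((hg e₁ e₁).mul (hg e₂ e₂)).sub ((hg e₁ e₂).pow 2)).sqrt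

theorem chartArea_lt_top (h : Metric M) (x : M) {K : Set M} (hK : IsCompact K)
    (hKx : K ⊆ (chartAt Plane x).source) : chartArea h x K < ⊤ := by
  set φ := extChartAt (𝓡 2) x with hφ
  have hs : K ⊆ φ.source := by rwa [hφ, extChartAt_source]
  have hae : AEMeasurable φ.symm
      (((volume : Measure Plane).restrict φ.target).withDensity
    fun y => ENNReal.ofReal (areaDensity h x (φ.symm y))) :=
    ((continuousOn_extChartAt_symm (I := 𝓡 2) x).aemeasurable
      (isOpen_extChartAt_target (I := 𝓡 2) x).measurableSet).mono_ac
      (withDensity_absolutelyContinuous _ _)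
  have hK' : IsCompact (φ '' K) := hK.image_of_continuousOn
    ((continuousOn_extChartAt (I := 𝓡 2) x).mono hs)
  rw [chartArea, Measure.map_apply_of_aemeasurable hae hK.measurableSet]
  have hcont : ContinuousOn (fun y => areaDensity h x (φ.symm y)) (φ '' K) := by
    refine (areaDensity_continuousOn h x).comp
      ((continuousOn_extChartAt_symm (I := 𝓡 2) x).mono ?_) ?_
    · rintro _ ⟨q, hq, rfl⟩
      exact φ.map_source (hs hq)
    · rintro _ ⟨q, hq, rfl⟩
      rw [φ.left_inv (hs hq)]
      exact hKx hq
  have hint := (hcont.integrableOn_compact hK' (μ := volume)).2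
  have hfin : ∫⁻ y in φ '' K, ENNReal.ofReal (areaDensity h x (φ.symm y)) < ⊤ :=
    (lintegral_mono fun y => by
      rw [← ofReal_norm]
      exact ENNReal.ofReal_le_ofReal (le_abs_self _)).trans_lt hint
  refine lt_of_le_of_lt ?_ hfin
  rw [withDensity_apply', Measure.restrict_restrict'
    (isOpen_extChartAt_target (I := 𝓡 2) x).measurableSet]
  exact lintegral_mono_set fun y hy => ⟨φ.symm y, hy.1, φ.right_inv hy.2⟩

instance area.instIsFiniteMeasure (h : Metric M) : IsFiniteMeasure (area h) := by
  set ρ := chartPartition M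
  have hK : ∀ x, IsCompact (tsupport (ρ x)) := fun x => (isClosed_tsupport _).isCompact
  have hle : ∀ x : M, (chartArea h x).withDensity (fun q => ENNReal.ofReal (ρ x q)) Set.univ ≤
      chartArea h x (tsupport (ρ x)) := by
    intro x
    rw [withDensity_apply _ MeasurableSet.univ, Measure.restrict_univ,
      ← lintegral_indicator_one (hK x).measurableSet]
    refine lintegral_mono fun q => ?_
    by_cases hq : q ∈ tsupport (ρ x)
    · rw [Set.indicator_of_mem hq]
      simpa using ρ.le_one x q
    · simp [image_eq_zero_of_notMem_tsupport hq]
  have hfin : {x | (Function.support (ρ x)).Nonempty}.Finite := by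
    simpa using ρ.locallyFinite.finite_nonempty_of_compact
  constructor
  rw [area, Measure.sum_apply _ MeasurableSet.univ,
    tsum_eq_sum (s := hfin.toFinset) (fun x hx => ?_)]
  · exact ENNReal.sum_lt_top.2 fun x _ => (hle x).trans_lt
      (chartArea_lt_top h x (hK x) (chartPartition_subordinate M x))
  · have : Function.support (ρ x) = ∅ := by
      simpa [Set.not_nonempty_iff_eq_empty] using hx
    refine le_antisymm ((hle x).trans ?_) zero_le
    simp [tsupport, this]


theorem integrable_of_smooth (h : Metric M) (f : Func M) : Integrable f (area h) :=
  f.contMDiff.continuous.integrable_of_hasCompactSupport (HasCompactSupport.of_compactSpace _)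

/-- The inclusion of the smooth functions into `L²(M)`. -/
def funToL2 (h : Metric M) : Func M →ₗ[ℝ] Lp ℝ 2 (area h) where
  toFun f := ContinuousMap.toLp 2 (area h) ℝ ⟨f, f.contMDiff.continuous⟩
  map_add' f g := map_add (ContinuousMap.toLp 2 (area h) ℝ)
    ⟨f, f.contMDiff.continuous⟩ ⟨g, g.contMDiff.continuous⟩
  map_smul' r f := map_smul (ContinuousMap.toLp 2 (area h) ℝ) r ⟨f, f.contMDiff.continuous⟩

/-- The smooth one-forms with the `L²` inner product `∫ ⟨b, c⟩ dA`. -/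
def PreL2Form (_h : Metric M) : Type _ := OneForm M

instance PreL2Form.instAddCommGroup (h : Metric M) : AddCommGroup (PreL2Form h) :=
  inferInstanceAs (AddCommGroup (OneForm M))

instance PreL2Form.instModule (h : Metric M) : Module ℝ (PreL2Form h) :=
  inferInstanceAs (Module ℝ (OneForm M))

instance PreL2Form.core (h : Metric M) : PreInnerProductSpace.Core ℝ (PreL2Form h) where
  inner b c := ∫ q, formInner h b c q ∂(area h)
  conj_inner_symm b c := by
    simp only [conj_trivial]
    refine integral_congr_ae (Filter.Eventually.of_forall fun q => ?_)
    exact formInner_comm h c b q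
  re_inner_nonneg b := integral_nonneg fun q => formInner_self_nonneg h b q
  add_left b c e := by
    rw [← integral_add (integrable_of_smooth h _) (integrable_of_smooth h _)]
    exact integral_congr_ae (Filter.Eventually.of_forall fun q => formInner_add h b c e q)
  smul_left b c r := by
    rw [conj_trivial, ← integral_const_mul]
    exact integral_congr_ae (Filter.Eventually.of_forall fun q => formInner_smul h r b c q)

instance PreL2Form.instSeminormed (h : Metric M) : SeminormedAddCommGroup (PreL2Form h) :=
  InnerProductSpace.Core.toSeminormedAddCommGroup (𝕜 := ℝ)

instance PreL2Form.instInner (h : Metric M) : InnerProductSpace ℝ (PreL2Form h) :=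
  InnerProductSpace.ofCore (PreL2Form.core h)

/-- The Hilbert space `L²(Ω¹(M))`: the completion of the smooth one-forms for the `L²` inner product. -/
abbrev L2Form (h : Metric M) : Type _ := UniformSpace.Completion (PreL2Form h)

/-- The inclusion of the smooth one-forms into `L²(Ω¹(M))`. -/
def formToL2 (h : Metric M) : OneForm M →ₗ[ℝ] L2Form h :=
  (UniformSpace.Completion.toComplₗᵢ (𝕜 := ℝ) (E := PreL2Form h)).toLinearMap

/-- The Hilbert space `L²(M) ⊕ L²(Ω¹(M))`. -/
abbrev L2Pair (h : Metric M) : Type _ := WithLp 2 (Lp ℝ 2 (area h) × L2Form h)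

/-- The inclusion of the smooth pairs `(v, b)` into `L²(M) ⊕ L²(Ω¹(M))`. -/
def pairToL2 (h : Metric M) : Func M × OneForm M →ₗ[ℝ] L2Pair h :=
  (WithLp.linearEquiv 2 ℝ (Lp ℝ 2 (area h) × L2Form h)).symm.toLinearMap ∘ₗ
    (funToL2 h).prodMap (formToL2 h)

end Measure

section Operators

/-- The codifferential `d*b = -⋆d⋆b` of a one-form. -/
def codiff : OneForm M →ₗ[ℝ] Func M := -(curl dV ∘ₗ hodgeStar dV)

/-- The codifferential `d*(f dV) = -⋆d⋆(f dV) = -⋆df` of the two-form `f dV`, as an operator in `f`. -/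
def codiffTwo : Func M →ₗ[ℝ] OneForm M := -(hodgeStar dV ∘ₗ diff)

/-- The divergence `div (f dV) = -d*(f dV)` of the two-form `f dV`, as an operator in `f`. -/
def divTwo : Func M →ₗ[ℝ] OneForm M := -codiffTwo dV

/-- The Laplace-Beltrami operator `Δ = -d*d` on functions. -/
def laplacian : Func M →ₗ[ℝ] Func M := -(codiff dV ∘ₗ diff)

/-- The Hodge-de Rham Laplacian `Δ_d = -(dd* + d*d)` on one-forms. -/
def hodgeLaplacian : OneForm M →ₗ[ℝ] OneForm M :=
  -(diff ∘ₗ codiff dV + codiffTwo dV ∘ₗ curl dV)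

/-- The linearized operator on smooth pairs,
`L(v, b) = (Δv + (R - λ²) v + λ ⟨db, dV⟩, Δ_d b - λ div (v dV))`. -/
def linearization (R lam : ℝ) : Func M × OneForm M →ₗ[ℝ] Func M × OneForm M :=
  (laplacian dV ∘ₗ LinearMap.fst ℝ _ _ + (R - lam ^ 2) • LinearMap.fst ℝ _ _ +
    lam • (curl dV ∘ₗ LinearMap.snd ℝ _ _)).prod
  (hodgeLaplacian dV ∘ₗ LinearMap.snd ℝ _ _ - lam • (divTwo dV ∘ₗ LinearMap.fst ℝ _ _))

theorem linearization_apply (R lam : ℝ) (v : Func M) (b : OneForm M) :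
    linearization dV R lam (v, b) =
      (laplacian dV v + (R - lam ^ 2) • v + lam • curl dV b,
        hodgeLaplacian dV b - lam • divTwo dV v) := rfl

end Operators

section Realization
variable {S H F : Type*} [AddCommGroup S] [Module ℝ S]
  [NormedAddCommGroup H] [InnerProductSpace ℝ H] [NormedAddCommGroup F] [NormedSpace ℝ F]

/-- The Sobolev space of order one defined by a first order operator `D` on the smooth elements `S` of
the Hilbert space `H` (embedded by `ι`): the limits in `H` of sequences `ι uₙ` for which `D uₙ`
converges too, that is, the domain of the closure of `D`. -/
def sobolev (ι : S →ₗ[ℝ] H) (D : S →ₗ[ℝ] F) : Submodule ℝ H :=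
  ((ι.prod D).range.topologicalClosure).map (LinearMap.fst ℝ H F)

/-- An operator `A` on the smooth elements, as a densely defined operator in the Hilbert space. -/
def smoothOperator (ι : S →ₗ[ℝ] H) (A : S →ₗ[ℝ] S) : H →ₗ.[ℝ] H :=
  (ι.prod (ι ∘ₗ A)).range.toLinearPMap

/-- The realization in `H` of a formally self-adjoint second order operator `A`: its domain consists of
the `u` in the Sobolev space of order one for which `A u`, in the sense of distributions, is some
`w` in `H` (`⟪w, ι φ⟫ = ⟪u, ι (A φ)⟫` for all smooth `φ`), and it sends `u` to `w`. -/
def realization [CompleteSpace H] (ι : S →ₗ[ℝ] H) (D : S →ₗ[ℝ] F) (A : S →ₗ[ℝ] S) : H →ₗ.[ℝ] H :=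
  (smoothOperator ι A).adjoint.domRestrict (sobolev ι D)

/-- `μ` lies in the resolvent set of (the complexification of) the real operator `T`: writing
elements of the complexified space as `x + iy`, the operator `T - μ` has a bounded everywhere
defined two-sided inverse `G`. -/
def IsResolventPoint (T : H →ₗ.[ℝ] H) (μ : ℂ) : Prop :=
  ∃ G : H × H →L[ℝ] H × H,
    (∀ f : H × H, ∃ x y : T.domain, G f = ((x : H), (y : H)) ∧
      T x - (μ.re • (x : H) - μ.im • (y : H)) = f.1 ∧
      T y - (μ.im • (x : H) + μ.re • (y : H)) = f.2) ∧
    ∀ x y : T.domain, G (T x - (μ.re • (x : H) - μ.im • (y : H)),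
      T y - (μ.im • (x : H) + μ.re • (y : H))) = ((x : H), (y : H))

/-- The spectrum of the real operator `T`, a set of complex numbers. -/
def spectrum (T : H →ₗ.[ℝ] H) : Set ℂ := {μ | ¬ IsResolventPoint T μ}

/-- The eigenspace of `T` for the eigenvalue zero. -/
def zeroEigenspace (T : H →ₗ.[ℝ] H) : Set H := {u | ∃ hu : u ∈ T.domain, T ⟨u, hu⟩ = 0}

end Realization

section L2
variable [CompactSpace M] [T2Space M] [MeasurableSpace M] [BorelSpace M]

/-- The first order operator `(v, b) ↦ (dv, ⟨db, dV⟩, d*b)`, with values in `L²`. -/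
def firstOrderPair : Func M × OneForm M →ₗ[ℝ] L2Form h × Lp ℝ 2 (area h) × Lp ℝ 2 (area h) :=
  (formToL2 h ∘ₗ diff ∘ₗ LinearMap.fst ℝ _ _).prod
    ((funToL2 h ∘ₗ curl dV ∘ₗ LinearMap.snd ℝ _ _).prod
      (funToL2 h ∘ₗ codiff dV ∘ₗ LinearMap.snd ℝ _ _))

/-- The first order operator `b ↦ (⟨db, dV⟩, d*b)`, with values in `L²`. -/
def firstOrderForm : OneForm M →ₗ[ℝ] Lp ℝ 2 (area h) × Lp ℝ 2 (area h) :=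
  (funToL2 h ∘ₗ curl dV).prod (funToL2 h ∘ₗ codiff dV)

/-- The linearized operator `L` in `L²(M) ⊕ L²(Ω¹(M))`. -/
def linearizedL2 (R lam : ℝ) : L2Pair h →ₗ.[ℝ] L2Pair h :=
  realization (pairToL2 h) (firstOrderPair dV) (linearization dV R lam)

/-- The Hodge-de Rham Laplacian `Δ_d` in `L²(Ω¹(M))`. -/
def hodgeLaplacianL2 : L2Form h →ₗ.[ℝ] L2Form h :=
  realization (formToL2 h) (firstOrderForm dV) (hodgeLaplacian dV)

/-- A one-form of class `L²` is harmonic if `Δ_d b = 0`. -/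
def IsHarmonicL2 (b : L2Form h) : Prop := b ∈ zeroEigenspace (hodgeLaplacianL2 dV)

end L2

section Curvature

/-- The partial derivative `∂ᵢ f`. -/
def partialDeriv (i : Fin 2) (f : Plane → ℝ) (y : Plane) : ℝ :=
  fderiv ℝ f y (EuclideanSpace.single i 1)

/-- The matrix `(hᵢⱼ)` of the metric in the chart at `x`. -/
def metricMatrix (h : Metric M) (x : M) (y : Plane) : Matrix (Fin 2) (Fin 2) ℝ :=
  Matrix.of fun i j => h.inner ((extChartAt (𝓡 2) x).symm y)
    (frame x _ (EuclideanSpace.single i 1)) (frame x _ (EuclideanSpace.single j 1))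

/-- The Christoffel symbol `Γᵏᵢⱼ` in the chart at `x`. -/
def christoffel (h : Metric M) (x : M) (k i j : Fin 2) (y : Plane) : ℝ :=
  1 / 2 * ∑ l, (metricMatrix h x y)⁻¹ k l *
    (partialDeriv i (fun z => metricMatrix h x z j l) y +
      partialDeriv j (fun z => metricMatrix h x z i l) y -
      partialDeriv l (fun z => metricMatrix h x z i j) y)

/-- The Ricci curvature `Rⱼₖ` in the chart at `x`. -/
def ricci (h : Metric M) (x : M) (j k : Fin 2) (y : Plane) : ℝ :=
  ∑ i, (partialDeriv i (christoffel h x i j k) y - partialDeriv j (christoffel h x i i k) y +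
    ∑ p, (christoffel h x i i p y * christoffel h x p j k y -
      christoffel h x i j p y * christoffel h x p i k y))

/-- The scalar curvature of `h` (equal to `2` on the unit sphere), computed at `q` in the chart
at `q`. -/
def scalarCurvature (h : Metric M) (q : M) : ℝ :=
  ∑ j, ∑ k, (metricMatrix h q (extChartAt (𝓡 2) q q))⁻¹ j k * ricci h q j k (extChartAt (𝓡 2) q q)

end Curvature

end Surface
end

/-! The operator factors as L = -D*D with D(v, b) = (dv, √(-R) v, d*b, ⟨db, dV⟩ - λv). The last
component absorbs, as one completed square, the term -λ²v, both coupling terms and the part of Δ_d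
coming from db; the square root exists because R ≤ 0. This is `inner_linearization_eq`. The
adjointness relations behind it, `inner_curl` and `inner_codiff`, come from Stokes' theorem
`integral_curl_eq_zero` applied to f b together with the Leibniz rule `curl_funMul`; the second is
reduced to the first by the isometry of the Hodge star.

Self-adjointness and the spectral bound are then abstract and need no elliptic regularity. D differs
from the first order operator defining the Sobolev space by bounded terms of order zero, so both
have closures with the same domain, and the realization of L is the Friedrichs extension of -D*D.
Its resolvent K = (1 + D*D)⁻¹ is obtained by projecting (f, 0) orthogonally onto the closed graph of
D, and 0 ≤ K ≤ 1 (`isContractiveResolvent_realization`). Self-adjointness follows from the symmetry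
of K. Off (-∞, 0], the operator is inverted by Lax-Milgram on the complexified space, after
multiplication by a suitable complex number.

The kernel of D*D is the kernel of the closure of D. There dv = 0, d*b = 0 and ⟨db, dV⟩ = λv, so
λ‖v‖² = (⟨db, dV⟩, v) = (b, d*(v dV)) = 0, because |d*(v dV)| = |dv|. As λ ≠ 0 this forces v = 0,
and b is closed and coclosed. In L² the argument is run along approximating sequences of smooth
pairs (`mem_zeroEigenspace_linearizedL2`). -/

noncomputable section
namespace Surface

set_option linter.unusedSectionVars false

open scoped InnerProductSpace

/-! ### Operators with a resolvent between 0 and 1: self-adjointness and spectrum. -/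

section Abstract
variable {S H F E : Type*} [AddCommGroup S] [Module ℝ S]
  [NormedAddCommGroup H] [InnerProductSpace ℝ H] [CompleteSpace H]
  [NormedAddCommGroup F] [NormedSpace ℝ F]
  [NormedAddCommGroup E] [InnerProductSpace ℝ E] [CompleteSpace E]

/-- A bounded operator on `H × H` which is coercive for the Hilbert sum inner product is invertible. -/
theorem exists_equiv_of_coercive (C : H × H →L[ℝ] H × H) {c : ℝ} (hc : 0 < c)
    (hC : ∀ z : H × H, c * (⟪z.1, z.1⟫_ℝ + ⟪z.2, z.2⟫_ℝ) ≤ ⟪(C z).1, z.1⟫_ℝ + ⟪(C z).2, z.2⟫_ℝ) :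
    ∃ e : (H × H) ≃L[ℝ] (H × H), ∀ z, e z = C z := by
  -- The product `H × H` carries the sup norm, so the operator is moved to the Hilbert sum, where
  -- Lax-Milgram applies.
  let P := WithLp.prodContinuousLinearEquiv 2 ℝ H H
  let C' : WithLp 2 (H × H) →L[ℝ] WithLp 2 (H × H) :=
    P.symm.toContinuousLinearMap ∘L C ∘L P.toContinuousLinearMap
  let B : WithLp 2 (H × H) →L[ℝ] WithLp 2 (H × H) →L[ℝ] ℝ := (innerSL ℝ) ∘L C'
  have hB : ∀ u v, B u v = ⟪C' u, v⟫_ℝ := fun u v => rfl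
  have hco : IsCoercive B := by
    refine ⟨c, hc, fun u => ?_⟩
    have h1 := hC (P u)
    rw [hB, mul_assoc, ← real_inner_self_eq_norm_mul_norm, WithLp.prod_inner_apply,
      WithLp.prod_inner_apply]
    exact h1
  have heq : ∀ u, hco.continuousLinearEquivOfBilin u = C' u := fun u =>
    ext_inner_right ℝ fun v => by rw [hco.continuousLinearEquivOfBilin_apply, hB]
  refine ⟨P.symm.trans (hco.continuousLinearEquivOfBilin.trans P), fun z => ?_⟩
  change P (hco.continuousLinearEquivOfBilin (P.symm z)) = _
  rw [heq]
  simp [C']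

/-- `K` is the inverse of `1 - T`, and `0 ≤ K ≤ 1`. -/
structure IsContractiveResolvent (T : H →ₗ.[ℝ] H) (K : H →L[ℝ] H) : Prop where
  symm (f g : H) : ⟪K f, g⟫_ℝ = ⟪f, K g⟫_ℝ
  nonneg (f : H) : 0 ≤ ⟪K f, f⟫_ℝ
  le_one (f : H) : ⟪K f, f⟫_ℝ ≤ ⟪f, f⟫_ℝ
  mem_graph (f : H) : (K f, K f - f) ∈ T.graph
  eq_of_mem_graph {x w : H} : (x, w) ∈ T.graph → K (x - w) = x

namespace IsContractiveResolvent
variable {T : H →ₗ.[ℝ] H} {K : H →L[ℝ] H} (hK : IsContractiveResolvent T K)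
include hK

theorem mem_domain (f : H) : K f ∈ T.domain :=
  LinearPMap.mem_domain_of_mem_graph (hK.mem_graph f)

theorem apply_eq (f : H) : T ⟨K f, hK.mem_domain f⟩ = K f - f := by
  obtain ⟨y, h1, h2⟩ := (LinearPMap.mem_graph_iff T).1 (hK.mem_graph f)
  have : y = ⟨K f, hK.mem_domain f⟩ := Subtype.ext h1
  rw [← this, h2]

theorem apply_sub (x : T.domain) : K (x - T x) = x := hK.eq_of_mem_graph (T.mem_graph x)

/-- The domain contains the range of `K`. A vector orthogonal to that range is killed by the
symmetric `K`, and `K` is injective because (0, -f) lies in a graph only for f = 0. -/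
theorem dense_domain : Dense (T.domain : Set H) := by
  rw [Submodule.dense_iff_topologicalClosure_eq_top,
    Submodule.topologicalClosure_eq_top_iff, Submodule.eq_bot_iff]
  intro f hf
  have h0 : K f = 0 := by
    refine ext_inner_right ℝ fun g => ?_
    rw [hK.symm, inner_zero_left, real_inner_comm]
    exact (Submodule.mem_orthogonal _ _).1 hf _ (hK.mem_domain g)
  have h1 := hK.mem_graph f
  rw [h0, zero_sub] at h1
  simpa using LinearPMap.graph_fst_eq_zero_snd T h1 rfl

/-- Symmetry of `K` gives symmetry of `T`. It also yields K(x - T*x) = x for x in the domain of the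
adjoint, so that domain lies in the range of `K`, hence in the domain of `T`. -/
theorem isSelfAdjoint : IsSelfAdjoint T := by
  have hd := hK.dense_domain
  have hsymm : T.IsFormalAdjoint T := by
    intro x y
    have hx := hK.apply_sub x
    have hy := hK.apply_sub y
    have h1 := hK.symm (x - T x) (y - T y)
    rw [hx, hy, inner_sub_right, inner_sub_left] at h1
    linarith
  rw [LinearPMap.isSelfAdjoint_def]
  refine le_antisymm ?_ (hsymm.le_adjoint hd)
  have key : ∀ x : T.adjoint.domain, K (x - T.adjoint x) = x := by
    intro x
    refine ext_inner_right ℝ fun g => ?_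
    have h1 := LinearPMap.adjoint_isFormalAdjoint hd x ⟨K g, hK.mem_domain g⟩
    rw [hK.apply_eq, inner_sub_right] at h1
    rw [hK.symm, inner_sub_left, h1]
    simp
  refine ⟨fun x hx => ?_, fun x y hxy => ?_⟩
  · have h1 := hK.mem_domain (x - T.adjoint ⟨x, hx⟩)
    rwa [key ⟨x, hx⟩] at h1
  · have h1 := hK.apply_eq (x - T.adjoint x)
    have h2 : (⟨K (x - T.adjoint x), hK.mem_domain _⟩ : T.domain) = y :=
      Subtype.ext ((key x).trans hxy)
    rw [h2, key x] at h1
    rw [h1]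
    abel

/-- The spectrum of an operator whose resolvent at `1` lies between `0` and `1` is contained in
`(-∞, 0]`. -/
theorem spectrum_subset : spectrum T ⊆ {μ : ℂ | μ.im = 0 ∧ μ.re ≤ 0} := by
  intro μ hμ
  by_contra hneg
  refine hμ ?_
  have hn : ‖μ‖ ^ 2 = μ.re ^ 2 + μ.im ^ 2 := by
    rw [Complex.sq_norm, Complex.normSq_apply]; ring
  have hn0 := norm_nonneg μ
  -- The number |μ| + Re μ vanishes exactly on (-∞, 0], so its positivity is the whole use of the
  -- assumption on μ.
  have hα : 0 < ‖μ‖ + μ.re := by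
    by_contra hle
    refine hneg ⟨?_, by linarith⟩
    have : μ.im ^ 2 ≤ 0 := by nlinarith
    nlinarith
  have hpos : 0 < ‖μ‖ := by
    refine lt_of_le_of_ne hn0 fun h0 => ?_
    have := Complex.abs_re_le_norm μ
    rw [← h0] at this hα
    have := abs_nonpos_iff.1 this
    linarith
  set α := ‖μ‖ + μ.re with hαdef
  -- Multiplication by a + ib on the complexification.
  let mul (a b : ℝ) : H × H →L[ℝ] H × H :=
    (a • ContinuousLinearMap.fst ℝ H H - b • ContinuousLinearMap.snd ℝ H H).prod
      (b • ContinuousLinearMap.fst ℝ H H + a • ContinuousLinearMap.snd ℝ H H)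
  have mul_apply : ∀ a b z, mul a b z = (a • z.1 - b • z.2, b • z.1 + a • z.2) := fun a b z => rfl
  let K₂ : H × H →L[ℝ] H × H := K.prodMap K
  -- B = 1 - K + μK, chosen so that (T - μ)K = -B; inverting T - μ thus reduces to inverting the
  -- bounded operator B.
  let B : H × H →L[ℝ] H × H := ContinuousLinearMap.id ℝ _ - K₂ + mul μ.re μ.im ∘L K₂
  have B_apply : ∀ z, B z = (z.1 - K z.1 + (μ.re • K z.1 - μ.im • K z.2),
    z.2 - K z.2 + (μ.im • K z.1 + μ.re • K z.2)) := fun z => rfl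
  have mul_inj : ∀ z, mul α (-μ.im) z = 0 → z = 0 := by
    intro z hz
    have h1 : mul α μ.im (mul α (-μ.im) z) = (α ^ 2 + μ.im ^ 2) • z := by
      simp only [mul_apply]
      ext <;> simp only [Prod.smul_fst, Prod.smul_snd] <;> module
    rw [hz, map_zero] at h1
    exact (smul_eq_zero.1 h1.symm).resolve_left (by positivity)
  -- The factor α - i Im μ = |μ| + conj μ has argument -arg(μ)/2, so it turns both 1 and μ into the
  -- open right half-plane: the real parts become α and |μ|α. Since 1 - K and K are nonnegative with
  -- sum 1, the smaller of the two is a coercivity constant.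
  obtain ⟨e, he⟩ := exists_equiv_of_coercive (mul α (-μ.im) ∘L B)
    (c := min α (‖μ‖ * α)) (lt_min hα (by positivity)) (by
    rintro ⟨x, y⟩
    have hsx := hK.symm x y
    have h1 := hK.nonneg x
    have h2 := hK.nonneg y
    have h3 := hK.le_one x
    have h4 := hK.le_one y
    have hyx := real_inner_comm x y
    rw [real_inner_comm] at hsx
    have e1 := real_inner_comm (K x) y
    have e2 := real_inner_comm (K y) x
    simp only [ContinuousLinearMap.comp_apply, mul_apply, B_apply]
    simp only [inner_add_left, inner_sub_left, real_inner_smul_left]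
    have m1 := mul_le_mul_of_nonneg_right (min_le_left α (‖μ‖ * α))
      (add_nonneg (sub_nonneg.2 h3) (sub_nonneg.2 h4))
    have m2 := mul_le_mul_of_nonneg_right (min_le_right α (‖μ‖ * α)) (add_nonneg h1 h2)
    have hre : α * μ.re + μ.im * μ.im = ‖μ‖ * α := by
      rw [hαdef]; linear_combination -hn
    generalize ⟪x, x⟫_ℝ = xx at *
    generalize ⟪y, y⟫_ℝ = yy at *
    generalize ⟪K x, x⟫_ℝ = kx at *
    generalize ⟪K y, y⟫_ℝ = ky at *
    have hxy2 : ⟪K y, x⟫_ℝ = ⟪K x, y⟫_ℝ := by linarith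
    rw [hxy2, hyx]
    calc _ ≤ α * (xx - kx + (yy - ky)) + ‖μ‖ * α * (kx + ky) := by linarith
      _ = _ := by rw [← hre]; ring)
  -- W = -B⁻¹, so the resolvent of `T` at μ is KW.
  let W : H × H →L[ℝ] H × H := -(e.symm.toContinuousLinearMap ∘L mul α (-μ.im))
  have hW : ∀ f, e (-W f) = mul α (-μ.im) f := fun f => by simp [W]
  have hBW : ∀ f, B (W f) = -f := by
    intro f
    rw [← add_eq_zero_iff_eq_neg]
    refine mul_inj _ ?_
    have h1 := hW f
    rw [he, ContinuousLinearMap.comp_apply, map_neg, map_neg] at h1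
    rw [map_add, ← h1, add_neg_cancel]
  have hWB : ∀ w, W (B w) = -w := by
    intro w
    have h1 := hW (B w)
    have h2 : e (-W (B w)) = e w := h1.trans (he w).symm
    exact neg_eq_iff_eq_neg.1 (e.injective h2)
  refine ⟨K₂ ∘L W, fun f => ⟨⟨K (W f).1, hK.mem_domain _⟩, ⟨K (W f).2, hK.mem_domain _⟩, rfl, ?_, ?_⟩,
    fun x y => ?_⟩
  · rw [hK.apply_eq]
    have h1 := congrArg Prod.fst (hBW f)
    rw [B_apply] at h1
    simp only [Prod.fst_neg] at h1
    rw [← neg_inj, ← h1]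
    abel
  · rw [hK.apply_eq]
    have h1 := congrArg Prod.snd (hBW f)
    rw [B_apply] at h1
    simp only [Prod.snd_neg] at h1
    rw [← neg_inj, ← h1]
    abel
  · have hx := hK.apply_sub x
    have hy := hK.apply_sub y
    have h1 : (T x - (μ.re • (x : H) - μ.im • (y : H)), T y - (μ.im • (x : H) + μ.re • (y : H))) =
        -B (x - T x, y - T y) := by
      rw [B_apply]
      simp only [hx, hy]
      ext <;> simp only [Prod.fst_neg, Prod.snd_neg] <;> abel
    rw [h1, map_neg, ContinuousLinearMap.comp_apply, hWB, map_neg, neg_neg]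
    exact Prod.ext hx hy

end IsContractiveResolvent

/-! ### Closed graphs and Sobolev spaces through sequences of smooth elements. -/

/-- The closure in the Hilbert sum `H ⊕ E` of the graph of `D`. -/
def graphClosure (ι : S →ₗ[ℝ] H) (D : S →ₗ[ℝ] E) : Submodule ℝ (WithLp 2 (H × E)) :=
  ((WithLp.linearEquiv 2 ℝ (H × E)).symm.toLinearMap ∘ₗ ι.prod D).range.topologicalClosure

theorem mem_graphClosure_of_smooth (ι : S →ₗ[ℝ] H) (D : S →ₗ[ℝ] E) (φ : S) :
    WithLp.toLp 2 (ι φ, D φ) ∈ graphClosure ι D :=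
  Submodule.le_topologicalClosure _ ⟨φ, rfl⟩

theorem exists_seq_of_mem_graphClosure {ι : S →ₗ[ℝ] H} {D : S →ₗ[ℝ] E} {x : H} {y : E}
    (hxy : WithLp.toLp 2 (x, y) ∈ graphClosure ι D) :
    ∃ u : ℕ → S, Filter.Tendsto (fun n => ι (u n)) Filter.atTop (𝓝 x) ∧
      Filter.Tendsto (fun n => D (u n)) Filter.atTop (𝓝 y) := by
  have hxy' : WithLp.toLp 2 (x, y) ∈ closure
      (((WithLp.linearEquiv 2 ℝ (H × E)).symm.toLinearMap ∘ₗ ι.prod D).range :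
        Set (WithLp 2 (H × E))) := hxy
  obtain ⟨z, hz, hlim⟩ := mem_closure_iff_seq_limit.1 hxy'
  choose u hu using hz
  have h1 := ((WithLp.prodContinuousLinearEquiv 2 ℝ H E).continuous.tendsto _).comp hlim
  have h2 : ∀ n, (WithLp.prodContinuousLinearEquiv 2 ℝ H E) (z n) = (ι (u n), D (u n)) :=
    fun n => by rw [← hu n]; rfl
  simp only [Function.comp_def, h2] at h1
  exact ⟨u, (continuous_fst.tendsto _).comp h1, (continuous_snd.tendsto _).comp h1⟩

theorem mem_graphClosure_of_seq {ι : S →ₗ[ℝ] H} {D : S →ₗ[ℝ] E} {x : H} {y : E} {u : ℕ → S}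
    (hx : Filter.Tendsto (fun n => ι (u n)) Filter.atTop (𝓝 x))
    (hy : Filter.Tendsto (fun n => D (u n)) Filter.atTop (𝓝 y)) :
    WithLp.toLp 2 (x, y) ∈ graphClosure ι D := by
  refine mem_closure_iff_seq_limit.2 ⟨fun n => WithLp.toLp 2 (ι (u n), D (u n)),
    fun n => ⟨u n, rfl⟩, ?_⟩
  exact ((WithLp.prodContinuousLinearEquiv 2 ℝ H E).symm.continuous.tendsto _).comp
    (hx.prodMk_nhds hy)

theorem mem_sobolev_of_seq {ι : S →ₗ[ℝ] H} {D : S →ₗ[ℝ] F} {x : H} {y : F} {u : ℕ → S}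
    (hx : Filter.Tendsto (fun n => ι (u n)) Filter.atTop (𝓝 x))
    (hy : Filter.Tendsto (fun n => D (u n)) Filter.atTop (𝓝 y)) : x ∈ sobolev ι D := by
  refine ⟨(x, y), mem_closure_iff_seq_limit.2 ⟨fun n => (ι (u n), D (u n)),
    fun n => ⟨u n, rfl⟩, hx.prodMk_nhds hy⟩, rfl⟩

theorem exists_seq_of_mem_sobolev {ι : S →ₗ[ℝ] H} {D : S →ₗ[ℝ] F} {x : H}
    (hx : x ∈ sobolev ι D) : ∃ (y : F) (u : ℕ → S),
      Filter.Tendsto (fun n => ι (u n)) Filter.atTop (𝓝 x) ∧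
      Filter.Tendsto (fun n => D (u n)) Filter.atTop (𝓝 y) := by
  obtain ⟨⟨x', y⟩, hxy, rfl⟩ := hx
  have hxy' : (x', y) ∈ closure ((ι.prod D).range : Set (H × F)) := hxy
  obtain ⟨z, hz, hlim⟩ := mem_closure_iff_seq_limit.1 hxy'
  choose u hu using hz
  refine ⟨y, u, ?_, ?_⟩
  · refine ((continuous_fst.tendsto _).comp hlim).congr fun n => ?_
    rw [Function.comp, ← hu n]; rfl
  · refine ((continuous_snd.tendsto _).comp hlim).congr fun n => ?_
    rw [Function.comp, ← hu n]; rfl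

/-! ### The Friedrichs extension of -D*D and its kernel. -/

section Friedrichs
variable {ι : S →ₗ[ℝ] H} {D₀ : S →ₗ[ℝ] F} {D : S →ₗ[ℝ] E} {A : S →ₗ[ℝ] S}
  (hι : DenseRange ι) (hA : ∀ φ ψ, ⟪ι (A φ), ι ψ⟫_ℝ = -⟪D φ, D ψ⟫_ℝ)
  (hD : ∀ x, x ∈ sobolev ι D₀ ↔ ∃ y, WithLp.toLp 2 (x, y) ∈ graphClosure ι D)

include hA in
theorem formally_symmetric (φ ψ : S) : ⟪ι (A φ), ι ψ⟫_ℝ = ⟪ι φ, ι (A ψ)⟫_ℝ := by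
  rw [hA, real_inner_comm (ι (A ψ)), hA, real_inner_comm]

-- The map `ι` is not assumed injective, so single-valuedness must be checked: if ι φ = 0, symmetry
-- makes ι (A φ) orthogonal to the dense range of `ι`.
include hι hA in
theorem smoothOperator_graph : (smoothOperator ι A).graph = (ι.prod (ι ∘ₗ A)).range := by
  refine Submodule.toLinearPMap_graph_eq _ ?_
  rintro _ ⟨φ, rfl⟩ h0
  have h0' : ι φ = 0 := h0
  change ι (A φ) = 0
  refine hι.eq_zero_of_inner_left ℝ fun ψ => ?_
  rw [formally_symmetric hA, h0', inner_zero_left]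

include hι in
theorem smoothOperator_dense : Dense ((smoothOperator ι A).domain : Set H) := by
  refine hι.mono ?_
  rintro _ ⟨φ, rfl⟩
  exact ⟨(ι φ, ι (A φ)), ⟨φ, rfl⟩, rfl⟩

-- Unfolds the adjoint of the smooth operator into the weak equation tested on smooth elements, the
-- only form in which the realization is used below.
include hι hA in
theorem mem_realization_graph {x w : H} : (x, w) ∈ (realization ι D₀ A).graph ↔
    x ∈ sobolev ι D₀ ∧ ∀ ψ, ⟪w, ι ψ⟫_ℝ = ⟪x, ι (A ψ)⟫_ℝ := by
  have hg : ∀ z : (smoothOperator ι A).domain, ∃ ψ, ι ψ = z ∧ ι (A ψ) = smoothOperator ι A z := by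
    intro z
    have := (smoothOperator ι A).mem_graph z
    rw [smoothOperator_graph hι hA] at this
    obtain ⟨ψ, hψ⟩ := this
    exact ⟨ψ, congrArg Prod.fst hψ, congrArg Prod.snd hψ⟩
  have hm : ∀ ψ, ∃ z : (smoothOperator ι A).domain, ι ψ = z ∧ ι (A ψ) = smoothOperator ι A z := by
    intro ψ
    have : (ι ψ, ι (A ψ)) ∈ (smoothOperator ι A).graph := by
      rw [smoothOperator_graph hι hA]
      exact ⟨ψ, rfl⟩
    obtain ⟨z, h1, h2⟩ := (LinearPMap.mem_graph_iff _).1 this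
    exact ⟨z, h1.symm, h2.symm⟩
  have hd := smoothOperator_dense (A := A) hι
  constructor
  · intro hxw
    obtain ⟨z, h1, h2⟩ := (LinearPMap.mem_graph_iff _).1 hxw
    simp only at h1 h2
    subst h1 h2
    refine ⟨z.2.1, fun ψ => ?_⟩
    obtain ⟨s, hs1, hs2⟩ := hm ψ
    rw [hs1, hs2]
    exact LinearPMap.adjoint_isFormalAdjoint hd ⟨z, z.2.2⟩ s
  · rintro ⟨hx, hw⟩
    have hw' : ∀ z : (smoothOperator ι A).domain, ⟪w, z⟫_ℝ = ⟪x, smoothOperator ι A z⟫_ℝ := by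
      intro z
      obtain ⟨ψ, h1, h2⟩ := hg z
      rw [← h1, ← h2]
      exact hw ψ
    have hxd := LinearPMap.mem_adjoint_domain_of_exists (T := smoothOperator ι A) x ⟨w, hw'⟩
    refine (LinearPMap.mem_graph_iff _).2 ⟨⟨x, hx, hxd⟩, rfl, ?_⟩
    exact LinearPMap.adjoint_apply_eq hd ⟨x, hxd⟩ hw'

include hA in
theorem inner_graphClosure {x : H} {y : E} (hxy : WithLp.toLp 2 (x, y) ∈ graphClosure ι D) (ψ : S) :
    ⟪x, ι (A ψ)⟫_ℝ = -⟪y, D ψ⟫_ℝ := by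
  obtain ⟨u, hx, hy⟩ := exists_seq_of_mem_graphClosure hxy
  refine tendsto_nhds_unique (hx.inner tendsto_const_nhds)
    ((hy.inner (tendsto_const_nhds (x := D ψ))).neg.congr fun n => ?_)
  rw [← hA, formally_symmetric hA]

/-- The inverse of `1 + D* D`: the first component of the orthogonal projection of `(f, 0)` onto the
closed graph of `D`. -/
def friedrichsResolvent (ι : S →ₗ[ℝ] H) (D : S →ₗ[ℝ] E) : H →L[ℝ] H :=
  haveI : CompleteSpace (graphClosure ι D) :=
    (Submodule.isClosed_topologicalClosure _).completeSpace_coe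
  ContinuousLinearMap.fst ℝ H E ∘L (WithLp.prodContinuousLinearEquiv 2 ℝ H E).toContinuousLinearMap ∘L
    (graphClosure ι D).starProjection ∘L
    (WithLp.prodContinuousLinearEquiv 2 ℝ H E).symm.toContinuousLinearMap ∘L
    ContinuousLinearMap.inl ℝ H E

/-- The residual (f, 0) - (Kf, y) of the projection is orthogonal to the closed graph; written out,
this is the weak form of Kf + D*D Kf = f, with y = D Kf. -/
theorem friedrichsResolvent_spec (ι : S →ₗ[ℝ] H) (D : S →ₗ[ℝ] E) (f : H) :
    ∃ y, WithLp.toLp 2 (friedrichsResolvent ι D f, y) ∈ graphClosure ι D ∧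
      ∀ a b, WithLp.toLp 2 (a, b) ∈ graphClosure ι D →
        ⟪f - friedrichsResolvent ι D f, a⟫_ℝ = ⟪y, b⟫_ℝ := by
  have : CompleteSpace (graphClosure ι D) :=
    (Submodule.isClosed_topologicalClosure _).completeSpace_coe
  set z := (graphClosure ι D).starProjection (WithLp.toLp 2 (f, 0)) with hz
  have h1 : friedrichsResolvent ι D f = z.fst := rfl
  refine ⟨z.snd, (graphClosure ι D).starProjection_apply_mem _, fun a b hab => ?_⟩
  have h2 := (graphClosure ι D).starProjection_inner_eq_zero (WithLp.toLp 2 (f, 0)) _ hab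
  rw [← hz, WithLp.prod_inner_apply] at h2
  have h3 : ⟪f - z.fst, a⟫_ℝ + ⟪0 - z.snd, b⟫_ℝ = 0 := h2
  rw [zero_sub, inner_neg_left] at h3
  rw [h1]
  linarith

/-- The projection is characterized by orthogonality of the residual, and by density that needs
testing only on the graph over smooth elements. -/
theorem friedrichsResolvent_eq {x f : H} {y : E}
    (hxy : WithLp.toLp 2 (x, y) ∈ graphClosure ι D)
    (h : ∀ ψ, ⟪f - x, ι ψ⟫_ℝ = ⟪y, D ψ⟫_ℝ) : friedrichsResolvent ι D f = x := by
  have : CompleteSpace (graphClosure ι D) :=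
    (Submodule.isClosed_topologicalClosure _).completeSpace_coe
  have h1 : (graphClosure ι D).starProjection (WithLp.toLp 2 (f, 0)) = WithLp.toLp 2 (x, y) := by
    refine Submodule.eq_starProjection_of_mem_of_inner_eq_zero hxy fun w hw => ?_
    obtain ⟨u, ha, hb⟩ := exists_seq_of_mem_graphClosure (x := w.fst) (y := w.snd) hw
    have h2 : ⟪f - x, w.fst⟫_ℝ = ⟪y, w.snd⟫_ℝ := by
      refine tendsto_nhds_unique (tendsto_const_nhds.inner ha)
        ((tendsto_const_nhds.inner hb).congr fun n => (h (u n)).symm)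
    rw [WithLp.prod_inner_apply]
    change ⟪f - x, w.fst⟫_ℝ + ⟪0 - y, w.snd⟫_ℝ = 0
    rw [h2, zero_sub, inner_neg_left, add_neg_cancel]
  change ((graphClosure ι D).starProjection (WithLp.toLp 2 (f, 0))).fst = x
  rw [h1]
  rfl

include hι hA hD in
/-- The realization of `A = -D* D` is the Friedrichs extension. -/
theorem isContractiveResolvent_realization :
    IsContractiveResolvent (realization ι D₀ A) (friedrichsResolvent ι D) where
  symm f g := by
    obtain ⟨y, hy, hy'⟩ := friedrichsResolvent_spec ι D f
    obtain ⟨y', hz, hz'⟩ := friedrichsResolvent_spec ι D g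
    have h1 := hy' _ _ hz
    have h2 := hz' _ _ hy
    rw [inner_sub_left] at h1 h2
    rw [real_inner_comm y y', real_inner_comm _ g,
      real_inner_comm (friedrichsResolvent ι D f) (friedrichsResolvent ι D g)] at h2
    linarith
  nonneg f := by
    obtain ⟨y, hy, hy'⟩ := friedrichsResolvent_spec ι D f
    have h1 := hy' _ _ hy
    rw [inner_sub_left, real_inner_comm] at h1
    have := real_inner_self_nonneg (x := y)
    have := real_inner_self_nonneg (x := friedrichsResolvent ι D f)
    linarith
  le_one f := by
    obtain ⟨y, hy, hy'⟩ := friedrichsResolvent_spec ι D f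
    have h1 := hy' _ _ hy
    have h2 := real_inner_self_nonneg (x := f - friedrichsResolvent ι D f)
    have := real_inner_self_nonneg (x := y)
    have e : ⟪f - friedrichsResolvent ι D f, f - friedrichsResolvent ι D f⟫_ℝ =
      ⟪f, f⟫_ℝ - ⟪friedrichsResolvent ι D f, f⟫_ℝ -
        ⟪f - friedrichsResolvent ι D f, friedrichsResolvent ι D f⟫_ℝ := by
      rw [inner_sub_right, inner_sub_left f]
    linarith
  mem_graph f := by
    obtain ⟨y, hy, hy'⟩ := friedrichsResolvent_spec ι D f
    refine (mem_realization_graph hι hA).2 ⟨(hD _).2 ⟨y, hy⟩, fun ψ => ?_⟩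
    rw [inner_graphClosure hA hy, ← hy' _ _ (mem_graphClosure_of_smooth ι D ψ), ← inner_neg_left,
      neg_sub]
  eq_of_mem_graph {x w} hxw := by
    obtain ⟨hx, hw⟩ := (mem_realization_graph hι hA).1 hxw
    obtain ⟨y, hy⟩ := (hD x).1 hx
    refine friedrichsResolvent_eq hy fun ψ => ?_
    have h1 := inner_graphClosure hA hy ψ
    rw [sub_sub_cancel_left, inner_neg_left, hw, h1, neg_neg]

-- The kernel of D*D is the kernel of the closure of `D`: if y is the value of the closure at x, the
-- weak equation makes y orthogonal to every D ψ, while y is itself a limit of such vectors, so y =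
-- 0.
include hι hA hD in
theorem mem_zeroEigenspace_realization {x : H} :
    x ∈ zeroEigenspace (realization ι D₀ A) ↔ WithLp.toLp 2 (x, (0 : E)) ∈ graphClosure ι D := by
  have h0 : x ∈ zeroEigenspace (realization ι D₀ A) ↔ (x, (0 : H)) ∈ (realization ι D₀ A).graph := by
    rw [LinearPMap.mem_graph_iff]
    constructor
    · rintro ⟨hx, h⟩
      exact ⟨⟨x, hx⟩, rfl, h⟩
    · rintro ⟨⟨x', hx⟩, rfl, h⟩
      exact ⟨hx, h⟩
  rw [h0, mem_realization_graph hι hA, hD]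
  constructor
  · rintro ⟨⟨y, hy⟩, h⟩
    have h1 : ∀ ψ, ⟪y, D ψ⟫_ℝ = 0 := fun ψ => by
      have h2 := inner_graphClosure hA hy ψ
      rw [← h ψ, inner_zero_left] at h2
      linarith
    obtain ⟨u, -, hu⟩ := exists_seq_of_mem_graphClosure hy
    have h3 : ⟪y, y⟫_ℝ = 0 := tendsto_nhds_unique (tendsto_const_nhds.inner hu)
      (tendsto_const_nhds.congr fun n => (h1 (u n)).symm)
    rwa [inner_self_eq_zero.1 h3] at hy
  · intro hx
    refine ⟨⟨0, hx⟩, fun ψ => ?_⟩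
    rw [inner_graphClosure hA hx, inner_zero_left, inner_zero_left, neg_zero]

include hι hA hD in
theorem realization_apply_smooth (φ : S) : ∃ hφ : ι φ ∈ (realization ι D₀ A).domain,
    realization ι D₀ A ⟨ι φ, hφ⟩ = ι (A φ) := by
  have h1 : (ι φ, ι (A φ)) ∈ (realization ι D₀ A).graph :=
    (mem_realization_graph hι hA).2 ⟨(hD _).2 ⟨_, mem_graphClosure_of_smooth ι D φ⟩,
      fun ψ => formally_symmetric hA φ ψ⟩
  obtain ⟨⟨x, hx⟩, rfl, h2⟩ := (LinearPMap.mem_graph_iff _).1 h1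
  exact ⟨hx, h2⟩

end Friedrichs
end Abstract

/-! ### Pointwise identities: area form, Hodge star, Leibniz rule. -/

section Geometry
variable {M : Type*} [TopologicalSpace M] [ChartedSpace Plane M] [IsManifold (𝓡 2) ∞ M]
variable {h : Metric M} (dV : AreaForm h)

theorem areaDensity_eq_abs (x q : M) :
    areaDensity h x q = |dV.form q (frame x q e₁) (frame x q e₂)| := by
  rw [areaDensity, ← dV.sq_eq, Real.sqrt_sq_eq_abs]

namespace AreaForm

theorem antisymm (q : M) (X Y : TangentSpace (𝓡 2) q) : dV.form q Y X = -dV.form q X Y := by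
  have h1 := dV.self_eq_zero q (X + Y)
  simp only [map_add, add_apply, dV.self_eq_zero] at h1
  linarith

/-- The polarized Gram identity: `dV ⊗ dV` is the curvature-like tensor of the metric. -/
theorem mul_eq (q : M) (X Y U W : TangentSpace (𝓡 2) q) :
    dV.form q X Y * dV.form q U W =
      h.inner q X U * h.inner q Y W - h.inner q X W * h.inner q Y U := by
  have hq := mem_chart_source Plane q
  have h1 := dV.sq_eq q (frame q q e₁) (frame q q e₂)
  have h2 := dV.antisymm q (frame q q e₁) (frame q q e₂)
  have h3 := dV.self_eq_zero q (frame q q e₁)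
  have h4 := dV.self_eq_zero q (frame q q e₂)
  have h5 := h.symm q (frame q q e₂) (frame q q e₁)
  obtain ⟨a, b, rfl⟩ := exists_frame hq X
  obtain ⟨c, d, rfl⟩ := exists_frame hq Y
  obtain ⟨a', b', rfl⟩ := exists_frame hq U
  obtain ⟨c', d', rfl⟩ := exists_frame hq W
  simp only [map_add, map_smul, add_apply, smul_apply, smul_eq_mul, h2, h3, h4, h5]
  -- Both sides are alternating in (X, Y) and in (U, W), hence equal the product of the two
  -- coordinate determinants times their value on the frame, where the Gram identity holds by
  -- definition.
  linear_combination ((a * d - b * c) * (a' * d' - b' * c')) * h1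

end AreaForm

theorem hodgeStar_apply (b : OneForm M) (q : M) :
    hodgeStar dV b q = dV.form q (sharp h q (b q)) := rfl

theorem formInner_apply (b c : OneForm M) (q : M) :
    formInner h b c q = c q (sharp h q (b q)) := rfl

/-- The Hodge star is an isometry. -/
theorem formInner_hodgeStar (b c : OneForm M) (q : M) :
    formInner h (hodgeStar dV b) (hodgeStar dV c) q = formInner h b c q := by
  have hne := dV.form_frame_ne_zero (mem_chart_source Plane q)
  rw [formInner_apply, formInner_apply, hodgeStar_apply dV c]
  set X := frame q q e₁
  set Y := frame q q e₂
  set U := sharp h q (b q)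
  set V := sharp h q (c q) with hV
  set Z := sharp h q (hodgeStar dV b q)
  have hZ : ∀ W, h.inner q Z W = dV.form q U W := fun W => by
    rw [inner_sharp]; rfl
  have hc : c q U = h.inner q V U := by rw [hV, inner_sharp]
  rw [hc]
  -- The nonzero factor dV(X, Y) turns dV(V, Z) into inner products by `mul_eq`, after which h(Z, ·)
  -- = dV(U, ·) removes Z.
  refine mul_left_cancel₀ hne ?_
  rw [dV.mul_eq, h.symm q Y Z, h.symm q X Z, hZ, hZ]
  obtain ⟨s, t, hst⟩ := exists_frame (mem_chart_source Plane q) U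
  rw [hst]
  have h2 := dV.antisymm q X Y
  simp only [map_add, map_smul, add_apply, smul_apply, smul_eq_mul, h.symm q V]
  change _ * (_ + t * dV.form q Y Y) - (s * dV.form q X X + t * dV.form q Y X) * _ = _
  rw [h2, dV.self_eq_zero, dV.self_eq_zero]
  ring

/-- `df ∧ b = ⟨⋆df, b⟩ dV`, for covectors. -/
theorem wedge_eq (b c : OneForm M) (q : M) (X Y : TangentSpace (𝓡 2) q) :
    b q X * c q Y - b q Y * c q X = dV.form q X Y * formInner h (hodgeStar dV b) c q := by
  have hb : ∀ X, b q X = h.inner q X (sharp h q (b q)) := fun X => by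
    rw [h.symm q X, inner_sharp]
  have hc : ∀ X, c q X = h.inner q X (sharp h q (c q)) := fun X => by
    rw [h.symm q X, inner_sharp]
  rw [formInner_comm, formInner_apply, hodgeStar_apply, dV.mul_eq, ← hb, ← hc, ← hb, ← hc]
  ring

/-- The product of a function and a one-form. -/
def funMul (f : Func M) (b : OneForm M) : OneForm M :=
  ⟨fun q => f q • b q, f.contMDiff.smul_section b.contMDiff⟩

theorem funMul_apply (f : Func M) (b : OneForm M) (q : M) : funMul f b q = f q • b q := rfl

theorem pull_differentiableAt (β : OneForm M) (x : M) {y : Plane}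
    (hy : y ∈ (extChartAt (𝓡 2) x).target) : DifferentiableAt ℝ (pull x β) y :=
  ((pull_contDiffOn β x).contDiffAt
    ((isOpen_extChartAt_target (I := 𝓡 2) x).mem_nhds hy)).differentiableAt (by simp)

theorem extDeriv_pullForm (β : OneForm M) (x : M) {y : Plane}
    (hy : y ∈ (extChartAt (𝓡 2) x).target) : extDeriv (pullForm x β) y ![e₁, e₂] =
      fderiv ℝ (pull x β) y e₁ e₂ - fderiv ℝ (pull x β) y e₂ e₁ := by
  have hd := pull_differentiableAt β x hy
  have hd' : DifferentiableAt ℝ (pullForm x β) y :=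
    ((pullForm_contDiffOn β x).contDiffAt
      ((isOpen_extChartAt_target (I := 𝓡 2) x).mem_nhds hy)).differentiableAt (by simp)
  have h1 : ∀ v : Fin 1 → Plane, (fun z => pullForm x β z v) = fun z => pull x β z (v 0) :=
    fun v => rfl
  have h2 : ∀ u v : Plane, fderiv ℝ (fun z => pull x β z u) y v = fderiv ℝ (pull x β) y v u := by
    intro u v
    rw [fderiv_clm_apply hd (differentiableAt_const u)]
    simp
  rw [extDeriv_apply hd']
  simp only [h1, h2]
  simp [Fin.removeNth, sub_eq_add_neg]

theorem curl_apply (β : OneForm M) {x q : M} (hx : q ∈ (chartAt Plane x).source) :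
    curl dV β q = (fderiv ℝ (pull x β) (extChartAt (𝓡 2) x q) e₁ e₂ -
      fderiv ℝ (pull x β) (extChartAt (𝓡 2) x q) e₂ e₁) /
        dV.form q (frame x q e₁) (frame x q e₂) := by
  have h1 : curl dV β q = curlIn dV x β q := curlIn_eq dV β hx (mem_chart_source Plane q)
  rw [h1, curlIn, extDeriv_pullForm]
  exact (extChartAt (𝓡 2) x).map_source (by simpa using hx)

/-- Tangent vectors at q are stored in the coordinates of the preferred chart at q, so the frame of
that chart is the identity there. -/
theorem frame_self (q : M) (u : Plane) : frame q q u = u := by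
  rw [frame, TangentBundle.symmL_trivializationAt_eq_core (mem_chart_source Plane q)]
  exact tangentCoordChange_self (I := 𝓡 2) (mem_extChartAt_source q)

theorem fderiv_comp_chart (f : Func M) (q : M) (u : Plane) :
    fderiv ℝ (fun y => f ((extChartAt (𝓡 2) q).symm y)) (extChartAt (𝓡 2) q q) u =
      diff f q (frame q q u) := by
  have h1 : diff f q (frame q q u) = fderivWithin ℝ (writtenInExtChartAt (𝓡 2) 𝓘(ℝ) q f)
      (Set.range (𝓡 2)) (extChartAt (𝓡 2) q q) u := by
    rw [frame_self]
    exact congrArg (fun T : Plane →L[ℝ] ℝ => T u)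
      (f.contMDiff.mdifferentiable (by simp) q).mfderiv
  rw [h1]
  simp only [modelWithCornersSelf_coe, Set.range_id, fderivWithin_univ]
  rfl

/-- The Leibniz rule `d(f b) = f db + df ∧ b`. -/
theorem curl_funMul (f : Func M) (b : OneForm M) (q : M) :
    curl dV (funMul f b) q = f q * curl dV b q + formInner h (hodgeStar dV (diff f)) b q := by
  have hq := mem_chart_source Plane q
  have hne := dV.form_frame_ne_zero hq
  set φ := extChartAt (𝓡 2) q with hφ
  have hy : φ q ∈ φ.target := φ.map_source (by simp [φ])
  have hb := pull_differentiableAt b q hy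
  have hf : DifferentiableAt ℝ (fun y => f (φ.symm y)) (φ q) := by
    have h1 : ContMDiffOn 𝓘(ℝ, Plane) 𝓘(ℝ) ∞ (fun y => f (φ.symm y)) φ.target :=
      f.contMDiff.comp_contMDiffOn (contMDiffOn_extChartAt_symm (I := 𝓡 2) (n := ∞) q)
    exact ((contMDiffOn_iff_contDiffOn.1 h1).contDiffAt
      ((isOpen_extChartAt_target (I := 𝓡 2) q).mem_nhds hy)).differentiableAt (by simp)
  have hpull : pull q (funMul f b) = fun y => f (φ.symm y) • pull q b y := rfl
  have hpq : ∀ u, pull q b (φ q) u = b q (frame q q u) := fun u => by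
    change b (φ.symm (φ q)) (frame q (φ.symm (φ q)) u) = _
    rw [φ.left_inv (by simp [φ])]
  have hw := wedge_eq dV (diff f) b q (frame q q e₁) (frame q q e₂)
  rw [curl_apply dV _ hq, curl_apply dV _ hq, ← hφ, hpull, fderiv_fun_smul hf hb]
  simp only [add_apply, smul_apply, ContinuousLinearMap.smulRight_apply, smul_eq_mul, hpq]
  rw [fderiv_comp_chart, fderiv_comp_chart, φ.left_inv (by simp [φ])]
  field_simp
  linear_combination hw

end Geometry

/-! ### The area measure in charts and its independence of the chart. -/

theorem det_plane (T : Plane →L[ℝ] Plane) :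
    T.det = T e₁ 0 * T e₂ 1 - T e₁ 1 * T e₂ 0 := by
  rw [ContinuousLinearMap.det, ← LinearMap.det_toMatrix (EuclideanSpace.basisFun (Fin 2) ℝ).toBasis,
    Matrix.det_fin_two]
  simp [LinearMap.toMatrix_apply]
  ring

section Measure
variable {M : Type*} [TopologicalSpace M] [ChartedSpace Plane M] [IsManifold (𝓡 2) ∞ M]
variable {h : Metric M} (dV : AreaForm h)

theorem areaDensity_pos (h : Metric M) {x q : M} (hx : q ∈ (chartAt Plane x).source) :
    0 < areaDensity h x q := Real.sqrt_pos.2 (gram_pos h hx)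

-- The density is |dV(∂₁, ∂₂)| and dV is alternating, so a change of chart multiplies it by the
-- absolute Jacobian determinant, exactly the factor in the change of variables formula.
include dV in
theorem areaDensity_change {x p q : M} (hx : q ∈ (chartAt Plane x).source)
    (hp : q ∈ (chartAt Plane p).source) :
    areaDensity h p q = |(tangentCoordChange (𝓡 2) p x q).det| * areaDensity h x q := by
  set T := tangentCoordChange (𝓡 2) p x q with hT
  have hF1 : frame p q e₁ = frame x q (T e₁) := frame_comp hx hp e₁
  have hF2 : frame p q e₂ = frame x q (T e₂) := frame_comp hx hp e₂
  let W : Plane →ₗ[ℝ] Plane →ₗ[ℝ] ℝ :=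
    LinearMap.mk₂ ℝ (fun u v => dV.form q (frame x q u) (frame x q v))
      (fun a b c => by simp only [map_add, add_apply])
      (fun r a c => by simp only [map_smul, smul_apply])
      (fun a b c => by simp only [map_add])
      (fun r a c => by simp only [map_smul])
  have hW : dV.form q (frame x q (T e₁)) (frame x q (T e₂)) =
      (T e₁ 0 * T e₂ 1 - T e₁ 1 * T e₂ 0) * dV.form q (frame x q e₁) (frame x q e₂) :=
    alt_comp W (fun u => dV.self_eq_zero q _) T
  rw [areaDensity_eq_abs dV, areaDensity_eq_abs dV, hF1, hF2, hW, det_plane, abs_mul]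

variable [CompactSpace M] [T2Space M] [MeasurableSpace M] [BorelSpace M]

theorem measurableSet_chart_image (x : M) {s : Set M} (hs : MeasurableSet s)
    (hsx : s ⊆ (chartAt Plane x).source) : MeasurableSet (extChartAt (𝓡 2) x '' s) := by
  set φ := extChartAt (𝓡 2) x with hφ
  rw [φ.image_eq_target_inter_inv_preimage (by rwa [hφ, extChartAt_source])]
  have h1 := (continuousOn_iff_continuous_domRestrict.1
    (continuousOn_extChartAt_symm (I := 𝓡 2) x)).measurable hs
  have h2 := (isOpen_extChartAt_target (I := 𝓡 2) x).measurableSet.subtype_image h1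
  convert h2 using 1
  ext y
  simp [hφ, and_comm]

theorem areaDensity_symm_continuousOn (h : Metric M) (x : M) :
    ContinuousOn (fun y => areaDensity h x ((extChartAt (𝓡 2) x).symm y))
      (extChartAt (𝓡 2) x).target :=
  (areaDensity_continuousOn h x).comp (continuousOn_extChartAt_symm (I := 𝓡 2) x)
    fun y hy => by simpa using (extChartAt (𝓡 2) x).map_target hy

theorem chart_symm_aemeasurable (h : Metric M) (x : M) : AEMeasurable (extChartAt (𝓡 2) x).symm
    (((volume : Measure Plane).restrict (extChartAt (𝓡 2) x).target).withDensity
      fun y => ENNReal.ofReal (areaDensity h x ((extChartAt (𝓡 2) x).symm y))) :=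
  ((continuousOn_extChartAt_symm (I := 𝓡 2) x).aemeasurable
    (isOpen_extChartAt_target (I := 𝓡 2) x).measurableSet).mono_ac
      (withDensity_absolutelyContinuous _ _)

theorem chartArea_apply' (h : Metric M) (x : M) {s : Set M} (hs : MeasurableSet s) :
    chartArea h x s = ∫⁻ y in (extChartAt (𝓡 2) x).target ∩ (extChartAt (𝓡 2) x).symm ⁻¹' s,
      ENNReal.ofReal (areaDensity h x ((extChartAt (𝓡 2) x).symm y)) := by
  rw [chartArea, Measure.map_apply_of_aemeasurable (chart_symm_aemeasurable h x) hs,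
    withDensity_apply', Measure.restrict_restrict'
      (isOpen_extChartAt_target (I := 𝓡 2) x).measurableSet, Set.inter_comm]

theorem chartArea_apply (h : Metric M) (x : M) {s : Set M} (hs : MeasurableSet s)
    (hsx : s ⊆ (chartAt Plane x).source) : chartArea h x s =
      ∫⁻ y in extChartAt (𝓡 2) x '' s,
        ENNReal.ofReal (areaDensity h x ((extChartAt (𝓡 2) x).symm y)) := by
  rw [chartArea_apply' h x hs, (extChartAt (𝓡 2) x).image_eq_target_inter_inv_preimage
    (by rwa [extChartAt_source])]

include dV in
/-- The area measures of two charts agree on the common domain. -/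
theorem chartArea_eq {x p : M} {s : Set M} (hs : MeasurableSet s)
    (hsx : s ⊆ (chartAt Plane x).source) (hsp : s ⊆ (chartAt Plane p).source) :
    chartArea h x s = chartArea h p s := by
  rw [chartArea_apply h x hs hsx, chartArea_apply h p hs hsp]
  set φ := extChartAt (𝓡 2) x with hφ
  set ψ := extChartAt (𝓡 2) p with hψ
  have hφs : ∀ q ∈ s, q ∈ φ.source := fun q hq => by simpa [hφ] using hsx hq
  have hψs : ∀ q ∈ s, q ∈ ψ.source := fun q hq => by simpa [hψ] using hsp hq
  have himg : φ '' s = (φ ∘ ψ.symm) '' (ψ '' s) := by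
    rw [← Set.image_comp]
    refine Set.image_congr fun q hq => ?_
    simp only [Function.comp]
    rw [ψ.left_inv (hψs q hq)]
  have hderiv : ∀ y ∈ ψ '' s, HasFDerivWithinAt (φ ∘ ψ.symm)
      (tangentCoordChange (𝓡 2) p x (ψ.symm y)) (ψ '' s) y := by
    rintro _ ⟨q, hq, rfl⟩
    have := hasFDerivWithinAt_tangentCoordChange (I := 𝓡 2) (x := p) (y := x) (z := q)
      ⟨hψs q hq, hφs q hq⟩
    rw [ψ.left_inv (hψs q hq)]
    exact this.mono (by simp)
  have hinj : Set.InjOn (φ ∘ ψ.symm) (ψ '' s) := by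
    rintro _ ⟨q, hq, rfl⟩ _ ⟨q', hq', rfl⟩ heq
    simp only [Function.comp, ψ.left_inv (hψs q hq), ψ.left_inv (hψs q' hq')] at heq
    rw [φ.injOn (hφs q hq) (hφs q' hq') heq]
  -- Change of variables along the transition map φ ∘ ψ⁻¹; its Jacobian is absorbed by
  -- `areaDensity_change`.
  rw [himg, lintegral_image_eq_lintegral_abs_det_fderiv_mul volume
    (measurableSet_chart_image p hs hsp) hderiv hinj]
  refine setLIntegral_congr_fun (measurableSet_chart_image p hs hsp) ?_
  rintro _ ⟨q, hq, rfl⟩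
  have e1 : ψ.symm (extChartAt (𝓡 2) p q) = q := ψ.left_inv (hψs q hq)
  simp only [Function.comp, e1, φ.left_inv (hφs q hq)]
  rw [areaDensity_change dV (hsx hq) (hsp hq), ENNReal.ofReal_mul (abs_nonneg _)]

theorem setLIntegral_inter_of_support {α : Type*} [MeasurableSpace α] (μ : Measure α)
    {f : α → ENNReal} {s t : Set α}
    (hf : Function.support f ⊆ t) (ht : MeasurableSet t) :
    ∫⁻ a in s, f a ∂μ = ∫⁻ a in s ∩ t, f a ∂μ := by
  rw [Set.inter_comm, ← setLIntegral_indicator ht, Set.indicator_eq_self.2 hf]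

include dV in
/-- On the domain of a chart, the area measure is the area measure of that chart. -/
theorem area_apply {p : M} {s : Set M} (hs : MeasurableSet s)
    (hsp : s ⊆ (chartAt Plane p).source) : area h s = chartArea h p s := by
  set ρ := chartPartition M with hρ
  have hsub : ∀ x, Function.support (fun q => ENNReal.ofReal (ρ x q)) ⊆ (chartAt Plane x).source := by
    intro x q hq
    refine chartPartition_subordinate M x (subset_tsupport _ ?_)
    intro h0
    exact hq (by simp [hρ, h0])
  have hm : ∀ x : M, MeasurableSet (chartAt Plane x).source := fun x =>
    (chartAt Plane x).open_source.measurableSet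
  -- The weight ρₓ lives in the chart at x and s in the chart at p, so only the overlap counts and
  -- there the two chart measures agree. Afterwards the weights sum to 1.
  have hterm : ∀ x, (chartArea h x).withDensity (fun q => ENNReal.ofReal (ρ x q)) s =
      ∫⁻ q in s, ENNReal.ofReal (ρ x q) ∂(chartArea h p) := by
    intro x
    rw [withDensity_apply _ hs, setLIntegral_inter_of_support (chartArea h x) (hsub x) (hm x),
      setLIntegral_inter_of_support (chartArea h p) (hsub x) (hm x)]
    congr 1
    ext t ht
    rw [Measure.restrict_apply ht, Measure.restrict_apply ht]
    exact chartArea_eq dV (ht.inter (hs.inter (hm x))) (fun q hq => hq.2.2)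
      (fun q hq => hsp hq.2.1)
  have hfin : {x | (Function.support (ρ x)).Nonempty}.Finite := by
    simpa using ρ.locallyFinite.finite_nonempty_of_compact
  have hzero : ∀ x ∉ hfin.toFinset, ∀ q, ρ x q = 0 := by
    intro x hx q
    by_contra hne
    exact hx (hfin.mem_toFinset.2 ⟨q, hne⟩)
  have hmeas : ∀ x, Measurable fun q => ENNReal.ofReal (ρ x q) := fun x =>
    ENNReal.measurable_ofReal.comp (ρ x).contMDiff.continuous.measurable
  rw [area, Measure.sum_apply _ hs, ← hρ]
  simp only [hterm]
  rw [tsum_eq_sum (s := hfin.toFinset) (fun x hx => by simp [hzero x hx]),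
    ← lintegral_finsetSum _ fun x _ => hmeas x]
  have hone : ∀ q, ∑ x ∈ hfin.toFinset, ENNReal.ofReal (ρ x q) = 1 := by
    intro q
    rw [← ENNReal.ofReal_sum_of_nonneg fun x _ => ρ.nonneg x q, ← ENNReal.ofReal_one,
      ← ρ.sum_eq_one (Set.mem_univ q), finsum_eq_sum_of_support_subset]
    intro x hx
    rw [Finset.mem_coe, hfin.mem_toFinset]
    exact ⟨q, hx⟩
  refine (lintegral_congr fun q => hone q).trans ?_
  rw [lintegral_one, Measure.restrict_apply_univ]

theorem chartArea_compl (h : Metric M) (p : M) : chartArea h p (chartAt Plane p).sourceᶜ = 0 := by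
  rw [chartArea_apply' h p (chartAt Plane p).open_source.measurableSet.compl]
  have : (extChartAt (𝓡 2) p).target ∩ (extChartAt (𝓡 2) p).symm ⁻¹' (chartAt Plane p).sourceᶜ = ∅ := by
    ext y
    simp only [Set.mem_inter_iff, Set.mem_preimage, Set.mem_compl_iff, Set.mem_empty_iff_false,
      iff_false, not_and, not_not]
    intro hy
    simpa using (extChartAt (𝓡 2) p).map_target hy
  rw [this]
  simp

include dV in
theorem area_restrict (p : M) : (area h).restrict (chartAt Plane p).source = chartArea h p := by
  have hm := (chartAt Plane p).open_source.measurableSet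
  ext s hs
  rw [Measure.restrict_apply hs, area_apply dV (hs.inter hm) Set.inter_subset_right]
  exact measure_inter_conull (chartArea_compl h p)

include dV in
theorem integral_area_eq (p : M) {g : M → ℝ} (hg : Continuous g)
    (hgp : Function.support g ⊆ (chartAt Plane p).source) :
    ∫ q, g q ∂(area h) = ∫ y in (extChartAt (𝓡 2) p).target,
      areaDensity h p ((extChartAt (𝓡 2) p).symm y) * g ((extChartAt (𝓡 2) p).symm y) := by
  have ht := (isOpen_extChartAt_target (I := 𝓡 2) p).measurableSet
  rw [← setIntegral_eq_integral_of_forall_compl_eq_zero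
    (s := (chartAt Plane p).source) (fun q hq => by_contra fun h0 => hq (hgp h0)),
    area_restrict dV, chartArea, integral_map (chart_symm_aemeasurable h p)
      hg.aestronglyMeasurable, integral_withDensity_eq_integral_toReal_smul₀]
  · refine setIntegral_congr_fun ht fun y hy => ?_
    simp only [smul_eq_mul]
    rw [ENNReal.toReal_ofReal (show 0 ≤ areaDensity h p _ from Real.sqrt_nonneg _)]
  · exact ENNReal.measurable_ofReal.comp_aemeasurable
      ((areaDensity_symm_continuousOn h p).aemeasurable ht)
  · exact Filter.Eventually.of_forall fun y => ENNReal.ofReal_lt_top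

-- Near any of its points an open set sees Lebesgue measure with a positive density. This is what
-- makes smooth functions equal as soon as they agree in L².
include dV in
theorem isOpenPosMeasure_area : (area h).IsOpenPosMeasure where
  open_pos U hU := by
    rintro ⟨p, hp⟩ h0
    have hV := hU.inter (chartAt Plane p).open_source
    have h1 := measure_mono_null (Set.inter_subset_left (t := (chartAt Plane p).source)) h0
    rw [area_apply dV hV.measurableSet Set.inter_subset_right,
      chartArea_apply' h p hV.measurableSet] at h1
    have ho := (continuousOn_extChartAt_symm (I := 𝓡 2) p).isOpen_inter_preimage
      (isOpen_extChartAt_target (I := 𝓡 2) p) hV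
    have hne : (volume : Measure Plane) ((extChartAt (𝓡 2) p).target ∩
        (extChartAt (𝓡 2) p).symm ⁻¹' (U ∩ (chartAt Plane p).source)) ≠ 0 := by
      refine (ho.measure_pos volume ⟨extChartAt (𝓡 2) p p, mem_extChartAt_target p, ?_⟩).ne'
      rw [Set.mem_preimage, extChartAt_to_inv]
      exact ⟨hp, mem_chart_source Plane p⟩
    have hae : AEMeasurable (fun y => ENNReal.ofReal
        (areaDensity h p ((extChartAt (𝓡 2) p).symm y))) (volume.restrict
          ((extChartAt (𝓡 2) p).target ∩
            (extChartAt (𝓡 2) p).symm ⁻¹' (U ∩ (chartAt Plane p).source))) :=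
      ENNReal.measurable_ofReal.comp_aemeasurable
        (((areaDensity_symm_continuousOn h p).mono Set.inter_subset_left).aemeasurable
          ho.measurableSet)
    rw [lintegral_eq_zero_iff' hae, Filter.EventuallyEq, ae_restrict_iff' ho.measurableSet] at h1
    refine hne (measure_mono_null ?_ h1)
    intro y hy hy'
    have h2 := hy' hy
    simp only [Pi.zero_apply, ENNReal.ofReal_eq_zero] at h2
    exact h2.not_gt (areaDensity_pos h hy.2.2)

/-! ### Stokes' theorem. -/

/-- The integral of a derivative of a compactly supported function vanishes. -/
theorem integral_fderiv_eq_zero {P : Plane → ℝ} (hP : ContDiff ℝ 1 P) (hc : HasCompactSupport P)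
    (v : Plane) : ∫ y, fderiv ℝ P y v = 0 := by
  have h1 : Integrable fun y => fderiv ℝ P y v :=
    ((hP.continuous_fderiv one_ne_zero).clm_apply continuous_const).integrable_of_hasCompactSupport
      (hc.fderiv_apply (𝕜 := ℝ) v)
  -- Integration by parts against the constant 1.
  have h2 := integral_mul_fderiv_eq_neg_fderiv_mul_of_integrable (μ := (volume : Measure Plane))
    (f := fun _ => (1 : ℝ)) (g := P) (v := v) (by simp) (by simpa using h1)
    (by simpa using hP.continuous.integrable_of_hasCompactSupport hc)
    (fun _ _ => differentiableAt_const _) (fun y _ => hP.differentiable one_ne_zero y)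
  simpa using h2

/-- Stokes' theorem for a one-form supported in a chart. -/
theorem integral_curl_eq_zero_of_support (p : M) (β : OneForm M) {K : Set M} (hK : IsCompact K)
    (hKp : K ⊆ (chartAt Plane p).source) (hβ : ∀ q ∉ K, β q = 0) :
    ∫ q, curl dV β q ∂(area h) = 0 := by
  set φ := extChartAt (𝓡 2) p with hφ
  have hKφ : K ⊆ φ.source := by rwa [hφ, extChartAt_source]
  have ht : IsOpen φ.target := isOpen_extChartAt_target (I := 𝓡 2) p
  have hK' : IsCompact (φ '' K) := hK.image_of_continuousOn
    ((continuousOn_extChartAt (I := 𝓡 2) p).mono hKφ)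
  let w : Plane → ℝ := fun y => dV.form (φ.symm y) (frame p (φ.symm y) e₁) (frame p (φ.symm y) e₂)
  have hwc : ContinuousOn w φ.target :=
    (form_frames_smooth dV.form dV.contMDiff p e₁ e₂).continuousOn.comp
      (continuousOn_extChartAt_symm (I := 𝓡 2) p)
      fun y hy => by simpa [hφ] using φ.map_target hy
  have hsrc : ∀ y ∈ φ.target, φ.symm y ∈ (chartAt Plane p).source := fun y hy => by
    simpa [hφ] using φ.map_target hy
  have hw0 : ∀ y ∈ φ.target, w y ≠ 0 := fun y hy => dV.form_frame_ne_zero (hsrc y hy)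
  have hpull0 : ∀ y ∈ φ.target, y ∉ φ '' K → pull p β y = 0 := by
    intro y hy hyK
    have : β (φ.symm y) = 0 := hβ _ fun hq => hyK ⟨_, hq, φ.right_inv hy⟩
    ext u
    change β (φ.symm y) (frame p (φ.symm y) u) = 0
    rw [this]
    rfl
  -- Charts need not be oriented: the density is |w|, whereas the curl has denominator w. The
  -- quotient sign(w) is locally constant on the chart, so it can be put into the covector field
  -- without affecting derivatives. Extension by zero is smooth because β vanishes off the compact
  -- K.
  let P : Plane → Plane →L[ℝ] ℝ := φ.target.indicator fun y => Real.sign (w y) • pull p β y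
  have hP0 : ∀ y ∉ φ '' K, P =ᶠ[𝓝 y] 0 := by
    intro y hy
    filter_upwards [hK'.isClosed.isOpen_compl.mem_nhds hy] with z hz
    by_cases hzt : z ∈ φ.target
    · simp only [P, Set.indicator_of_mem hzt, hpull0 z hzt hz, smul_zero, Pi.zero_apply]
    · simp only [P, Set.indicator_of_notMem hzt, Pi.zero_apply]
  have hP1 : ∀ y ∈ φ.target, P =ᶠ[𝓝 y] fun z => Real.sign (w y) • pull p β z := by
    intro y hy
    have hsign : ∀ᶠ z in 𝓝 y, Real.sign (w z) = Real.sign (w y) := by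
      have hc := hwc.continuousAt (ht.mem_nhds hy)
      rcases lt_or_gt_of_ne (hw0 y hy) with hlt | hgt
      · filter_upwards [hc.eventually_lt_const hlt] with z hz
        rw [Real.sign_of_neg hz, Real.sign_of_neg hlt]
      · filter_upwards [hc.eventually_const_lt hgt] with z hz
        rw [Real.sign_of_pos hz, Real.sign_of_pos hgt]
    filter_upwards [ht.mem_nhds hy, hsign] with z hz hzs
    simp only [P, Set.indicator_of_mem hz, hzs]
  have hPs : ContDiff ℝ 1 P := by
    rw [contDiff_iff_contDiffAt]
    intro y
    by_cases hy : y ∈ φ.target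
    · refine ContDiffAt.congr_of_eventuallyEq ?_ (hP1 y hy)
      exact ContDiffAt.smul (f := fun _ => Real.sign (w y)) contDiffAt_const
        (((pull_contDiffOn β p).contDiffAt (ht.mem_nhds hy)).of_le (by norm_cast))
    · refine ContDiffAt.congr_of_eventuallyEq contDiffAt_const (hP0 y fun hyK => hy ?_)
      obtain ⟨q, hq, rfl⟩ := hyK
      exact φ.map_source (hKφ hq)
  have hPc : HasCompactSupport P := HasCompactSupport.intro hK' fun y hy => (hP0 y hy).self_of_nhds
  have hint : ∀ u v : Plane, ∫ y, fderiv ℝ P y v u = 0 := by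
    intro u v
    have h1 : ContDiff ℝ 1 fun y => P y u := hPs.clm_apply contDiff_const
    have h2 : HasCompactSupport fun y => P y u :=
      hPc.comp_left (g := fun T : Plane →L[ℝ] ℝ => T u) rfl
    have h3 := integral_fderiv_eq_zero h1 h2 v
    rw [← h3]
    refine integral_congr_ae (Filter.Eventually.of_forall fun y => ?_)
    simp only
    rw [fderiv_clm_apply (hPs.differentiable one_ne_zero y) (differentiableAt_const u)]
    simp
  have hintegrable : ∀ u v : Plane, Integrable fun y => fderiv ℝ P y v u := fun u v =>
    (((hPs.continuous_fderiv one_ne_zero).clm_apply continuous_const).clm_apply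
      continuous_const).integrable_of_hasCompactSupport
      ((hPc.fderiv_apply (𝕜 := ℝ) v).comp_left (g := fun T : Plane →L[ℝ] ℝ => T u) rfl)
  have hKc := hK.isClosed.isOpen_compl
  have hsupp : Function.support (curl dV β) ⊆ (chartAt Plane p).source := by
    intro q hq
    by_contra hqp
    refine hq ?_
    have hqK : q ∉ K := fun hqK => hqp (hKp hqK)
    have hz : pull q β =ᶠ[𝓝 (extChartAt (𝓡 2) q q)] fun _ => 0 := by
      have hc := (continuousAt_extChartAt_symm (I := 𝓡 2) q)
      have hn : Kᶜ ∈ 𝓝 ((extChartAt (𝓡 2) q).symm (extChartAt (𝓡 2) q q)) := by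
        rw [extChartAt_to_inv]
        exact hKc.mem_nhds hqK
      filter_upwards [hc.preimage_mem_nhds hn] with y hy
      ext u
      change β ((extChartAt (𝓡 2) q).symm y) (frame q ((extChartAt (𝓡 2) q).symm y) u) = 0
      rw [hβ _ hy]
      rfl
    rw [curl_apply dV β (mem_chart_source Plane q), hz.fderiv_eq]
    simp
  rw [integral_area_eq dV p (curl dV β).contMDiff.continuous hsupp, ← hφ]
  -- The area density cancels the denominator of the curl, leaving a combination of derivatives of
  -- P, each with zero integral over the plane.
  have hkey : ∀ y ∈ φ.target, areaDensity h p (φ.symm y) * curl dV β (φ.symm y) =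
      fderiv ℝ P y e₁ e₂ - fderiv ℝ P y e₂ e₁ := by
    intro y hy
    rw [curl_apply dV β (hsrc y hy), areaDensity_eq_abs dV, (hP1 y hy).fderiv_eq,
      fderiv_fun_const_smul (pull_differentiableAt β p hy), ← hφ, φ.right_inv hy]
    simp only [smul_apply, smul_eq_mul]
    have h1 : |w y| = Real.sign (w y) * w y := by
      rcases lt_or_gt_of_ne (hw0 y hy) with hlt | hgt
      · rw [Real.sign_of_neg hlt, abs_of_neg hlt]; ring
      · rw [Real.sign_of_pos hgt, abs_of_pos hgt]; ring
    change |w y| * (_ / w y) = _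
    have := hw0 y hy
    rw [h1]
    field_simp
  rw [setIntegral_congr_fun ht.measurableSet hkey, setIntegral_eq_integral_of_forall_compl_eq_zero,
    integral_sub (hintegrable _ _) (hintegrable _ _), hint, hint, sub_zero]
  intro y hy
  rw [(hP0 y fun hyK => hy ?_).fderiv_eq]
  · simp
  · obtain ⟨q, hq, rfl⟩ := hyK
    exact φ.map_source (hKφ hq)

/-- Stokes' theorem on the closed surface. -/
theorem integral_curl_eq_zero (β : OneForm M) : ∫ q, curl dV β q ∂(area h) = 0 := by
  set ρ := chartPartition M with hρ
  have hfin : {x | (Function.support (ρ x)).Nonempty}.Finite := by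
    simpa using ρ.locallyFinite.finite_nonempty_of_compact
  -- By compactness only finitely many members of the partition are nonzero, so β is a finite sum of
  -- forms supported in charts.
  have hsum : β = ∑ x ∈ hfin.toFinset, funMul (ρ x) β := by
    ext q : 1
    have h1 : (∑ x ∈ hfin.toFinset, funMul (ρ x) β : OneForm M) q =
        ∑ x ∈ hfin.toFinset, funMul (ρ x) β q := by
      have h2 := congrFun (map_sum (ContMDiffSection.coeAddHom (𝓡 2) (Plane →L[ℝ] ℝ) ∞
        (fun x : M => TangentSpace (𝓡 2) x →L[ℝ] ℝ)) (fun x => funMul (ρ x) β) hfin.toFinset) q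
      rw [Finset.sum_apply] at h2
      exact h2
    rw [h1]
    simp only [funMul_apply]
    rw [← Finset.sum_smul, ← finsum_eq_sum_of_support_subset, ρ.sum_eq_one (Set.mem_univ q),
      one_smul]
    intro x hx
    rw [Finset.mem_coe, hfin.mem_toFinset]
    exact ⟨q, hx⟩
  rw [hsum, map_sum]
  have h2 : ∀ q, (∑ x ∈ hfin.toFinset, curl dV (funMul (ρ x) β) : Func M) q =
      ∑ x ∈ hfin.toFinset, curl dV (funMul (ρ x) β) q := by
    intro q
    have h3 := congrFun (map_sum (ContMDiffMap.coeFnAddMonoidHom (I := 𝓡 2) (N := M) (n := ∞)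
      (I' := 𝓘(ℝ)) (G := ℝ)) (fun x => curl dV (funMul (ρ x) β)) hfin.toFinset) q
    rw [Finset.sum_apply] at h3
    exact h3
  simp only [h2]
  rw [integral_finsetSum _ fun x _ => integrable_of_smooth h _]
  refine Finset.sum_eq_zero fun x _ => ?_
  refine integral_curl_eq_zero_of_support dV x _ (K := tsupport (ρ x)) (isClosed_tsupport _).isCompact
    (chartPartition_subordinate M x) fun q hq => ?_
  rw [funMul_apply, image_eq_zero_of_notMem_tsupport hq, zero_smul]

end Measure

/-! ### Linear maps into Hilbert sums. -/

section HilbertSum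
variable {S E₁ E₂ : Type*} [AddCommGroup S] [Module ℝ S]
  [NormedAddCommGroup E₁] [InnerProductSpace ℝ E₁] [NormedAddCommGroup E₂] [InnerProductSpace ℝ E₂]

/-- The pair of two linear maps, with values in the Hilbert sum. -/
def hilbertProd (A : S →ₗ[ℝ] E₁) (B : S →ₗ[ℝ] E₂) : S →ₗ[ℝ] WithLp 2 (E₁ × E₂) :=
  (WithLp.linearEquiv 2 ℝ (E₁ × E₂)).symm.toLinearMap ∘ₗ A.prod B

theorem inner_hilbertProd (A : S →ₗ[ℝ] E₁) (B : S →ₗ[ℝ] E₂) (φ ψ : S) :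
    ⟪hilbertProd A B φ, hilbertProd A B ψ⟫_ℝ = ⟪A φ, A ψ⟫_ℝ + ⟪B φ, B ψ⟫_ℝ :=
  WithLp.prod_inner_apply _ _

theorem tendsto_toLp {α : Type*} {l : Filter α} {f : α → WithLp 2 (E₁ × E₂)} {a : WithLp 2 (E₁ × E₂)} :
    Filter.Tendsto f l (𝓝 a) ↔ Filter.Tendsto (fun n => (f n).fst) l (𝓝 a.fst) ∧
      Filter.Tendsto (fun n => (f n).snd) l (𝓝 a.snd) := by
  rw [← (WithLp.prodContinuousLinearEquiv 2 ℝ E₁ E₂).toHomeomorph.isInducing.tendsto_nhds_iff.symm]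
  exact Prod.tendsto_iff _ _

end HilbertSum

/-! ### L² inner products, formal adjoints and density of smooth elements. -/

section L2
variable {M : Type*} [TopologicalSpace M] [ChartedSpace Plane M] [IsManifold (𝓡 2) ∞ M]
  [CompactSpace M] [T2Space M] [MeasurableSpace M] [BorelSpace M]
variable {h : Metric M} (dV : AreaForm h)

theorem inner_funToL2 (f g : Func M) :
    ⟪funToL2 h f, funToL2 h g⟫_ℝ = ∫ q, f q * g q ∂(area h) := by
  refine (ContinuousMap.inner_toLp (𝕜 := ℝ) (area h) ⟨f, f.contMDiff.continuous⟩
    ⟨g, g.contMDiff.continuous⟩).trans (integral_congr_ae (Filter.Eventually.of_forall fun q => ?_))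
  simp [mul_comm]

theorem inner_formToL2 (b c : OneForm M) :
    ⟪formToL2 h b, formToL2 h c⟫_ℝ = ∫ q, formInner h b c q ∂(area h) :=
  UniformSpace.Completion.inner_coe (𝕜 := ℝ) (E := PreL2Form h) b c

/-- `d*` on two-forms is the formal adjoint of `d` on one-forms. -/
theorem inner_curl (b : OneForm M) (f : Func M) :
    ⟪funToL2 h (curl dV b), funToL2 h f⟫_ℝ = ⟪formToL2 h b, formToL2 h (codiffTwo dV f)⟫_ℝ := by
  -- Stokes for f b: the Leibniz rule splits the vanishing integral into (f, ⟨db, dV⟩) and (⋆df, b),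
  -- and d*(f dV) = -⋆df.
  have h0 := integral_curl_eq_zero dV (funMul f b)
  simp only [curl_funMul] at h0
  have hi : Integrable (fun q => f q * curl dV b q) (area h) :=
    (f.contMDiff.continuous.mul (curl dV b).contMDiff.continuous).integrable_of_hasCompactSupport
      (HasCompactSupport.of_compactSpace _)
  rw [integral_add hi (integrable_of_smooth h _)] at h0
  have h1 : codiffTwo dV f = -hodgeStar dV (diff f) := rfl
  rw [h1, map_neg, inner_neg_right, inner_funToL2, real_inner_comm, inner_formToL2]
  simp only [mul_comm (curl dV b _)]
  linarith

/-- `d*` on one-forms is the formal adjoint of `d` on functions. -/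
theorem inner_codiff (b : OneForm M) (f : Func M) :
    ⟪funToL2 h (codiff dV b), funToL2 h f⟫_ℝ = ⟪formToL2 h b, formToL2 h (diff f)⟫_ℝ := by
  have h1 : codiff dV b = -curl dV (hodgeStar dV b) := rfl
  have h2 : codiffTwo dV f = -hodgeStar dV (diff f) := rfl
  rw [h1, map_neg, inner_neg_left, inner_curl, h2, map_neg, inner_neg_right, neg_neg,
    inner_formToL2, inner_formToL2]
  simp only [formInner_hodgeStar]

/-- An element orthogonal to all smooth functions is integrable, as the area is finite, and
integrates to zero against every smooth test function; hence it vanishes almost everywhere. -/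
theorem denseRange_funToL2 (h : Metric M) : DenseRange (funToL2 h) := by
  change Dense (Set.range (funToL2 h))
  rw [← LinearMap.coe_range, Submodule.dense_iff_topologicalClosure_eq_top,
    Submodule.topologicalClosure_eq_top_iff, Submodule.eq_bot_iff]
  intro g hg
  have hint : Integrable g (area h) := (Lp.memLp g).integrable (by norm_num)
  rw [Lp.eq_zero_iff_ae_eq_zero]
  refine ae_eq_zero_of_integral_contMDiff_smul_eq_zero (𝓡 2) hint.locallyIntegrable fun f hf _ => ?_
  have h1 := (Submodule.mem_orthogonal _ _).1 hg _ ⟨⟨f, hf⟩, rfl⟩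
  rw [L2.inner_def] at h1
  rw [← h1]
  refine integral_congr_ae ?_
  filter_upwards [ContinuousMap.coeFn_toLp (p := 2) (𝕜 := ℝ) (area h) ⟨f, hf.continuous⟩] with q hq
  have hq' : (funToL2 h ⟨f, hf⟩ : M → ℝ) q = f q := hq
  rw [hq']
  simp [mul_comm]

theorem denseRange_formToL2 (h : Metric M) : DenseRange (formToL2 h) :=
  UniformSpace.Completion.denseRange_coe (α := PreL2Form h)

theorem denseRange_pairToL2 (h : Metric M) : DenseRange (pairToL2 h) :=
  (WithLp.prodContinuousLinearEquiv 2 ℝ (Lp ℝ 2 (area h)) (L2Form h)).symm.surjective.denseRange.comp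
    ((denseRange_funToL2 h).prodMap (denseRange_formToL2 h))
    (WithLp.prodContinuousLinearEquiv 2 ℝ (Lp ℝ 2 (area h)) (L2Form h)).symm.continuous

include dV in
theorem funToL2_injective : Function.Injective (funToL2 h) := by
  have := isOpenPosMeasure_area dV
  intro f g hfg
  have h1 := ContinuousMap.toLp_injective (p := 2) (𝕜 := ℝ) (area h)
    (a₁ := ⟨f, f.contMDiff.continuous⟩) (a₂ := ⟨g, g.contMDiff.continuous⟩) hfg
  ext q
  exact DFunLike.congr_fun h1 q

end L2

/-! ### The factorization L = -D*D, domains and kernels. -/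

section Main
variable {M : Type*} [TopologicalSpace M] [ChartedSpace Plane M] [IsManifold (𝓡 2) ∞ M]
  [CompactSpace M] [T2Space M] [MeasurableSpace M] [BorelSpace M]
variable {h : Metric M} (dV : AreaForm h)

/-- The operator `D(v, b) = (dv, √(-R) v, d*b, ⟨db, dV⟩ - λ v)`, for which `L = -D*D`. -/
def pairGradient (R lam : ℝ) : Func M × OneForm M →ₗ[ℝ] WithLp 2 (L2Form h ×
    WithLp 2 (Lp ℝ 2 (area h) × WithLp 2 (Lp ℝ 2 (area h) × Lp ℝ 2 (area h)))) :=
  hilbertProd (formToL2 h ∘ₗ diff ∘ₗ LinearMap.fst ℝ _ _)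
    (hilbertProd (√(-R) • (funToL2 h ∘ₗ LinearMap.fst ℝ _ _))
      (hilbertProd (funToL2 h ∘ₗ codiff dV ∘ₗ LinearMap.snd ℝ _ _)
        (funToL2 h ∘ₗ curl dV ∘ₗ LinearMap.snd ℝ _ _ - lam • (funToL2 h ∘ₗ LinearMap.fst ℝ _ _))))

/-- The operator `D b = (d*b, ⟨db, dV⟩)`, for which `Δ_d = -D*D`. -/
def formGradient : OneForm M →ₗ[ℝ] WithLp 2 (Lp ℝ 2 (area h) × Lp ℝ 2 (area h)) :=
  hilbertProd (funToL2 h ∘ₗ codiff dV) (funToL2 h ∘ₗ curl dV)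

theorem hodgeLaplacian_apply (b : OneForm M) : hodgeLaplacian dV b =
    -(diff (codiff dV b) + codiffTwo dV (curl dV b)) := rfl

theorem inner_hodgeLaplacian (b c : OneForm M) :
    ⟪formToL2 h (hodgeLaplacian dV b), formToL2 h c⟫_ℝ =
      -(⟪funToL2 h (codiff dV b), funToL2 h (codiff dV c)⟫_ℝ +
        ⟪funToL2 h (curl dV b), funToL2 h (curl dV c)⟫_ℝ) := by
  rw [hodgeLaplacian_apply, map_neg, map_add, inner_neg_left, inner_add_left, real_inner_comm,
    ← inner_codiff, real_inner_comm _ (formToL2 h (codiffTwo dV _)), ← inner_curl,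
    real_inner_comm, real_inner_comm (funToL2 h (curl dV c))]

theorem inner_hodgeLaplacian_eq (b c : OneForm M) :
    ⟪formToL2 h (hodgeLaplacian dV b), formToL2 h c⟫_ℝ =
      -⟪formGradient dV b, formGradient dV c⟫_ℝ := by
  rw [inner_hodgeLaplacian, formGradient, inner_hilbertProd]
  rfl

theorem inner_pairToL2 (φ ψ : Func M × OneForm M) : ⟪pairToL2 h φ, pairToL2 h ψ⟫_ℝ =
    ⟪funToL2 h φ.1, funToL2 h ψ.1⟫_ℝ + ⟪formToL2 h φ.2, formToL2 h ψ.2⟫_ℝ :=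
  WithLp.prod_inner_apply _ _

theorem inner_pairGradient {R : ℝ} (hR : R ≤ 0) (lam : ℝ) (φ ψ : Func M × OneForm M) :
    ⟪pairGradient dV R lam φ, pairGradient dV R lam ψ⟫_ℝ =
      ⟪formToL2 h (diff φ.1), formToL2 h (diff ψ.1)⟫_ℝ - R * ⟪funToL2 h φ.1, funToL2 h ψ.1⟫_ℝ +
      ⟪funToL2 h (codiff dV φ.2), funToL2 h (codiff dV ψ.2)⟫_ℝ +
      ⟪funToL2 h (curl dV φ.2) - lam • funToL2 h φ.1,
        funToL2 h (curl dV ψ.2) - lam • funToL2 h ψ.1⟫_ℝ := by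
  have hs : √(-R) * √(-R) = -R := Real.mul_self_sqrt (by linarith)
  have h1 : ⟪√(-R) • funToL2 h φ.1, √(-R) • funToL2 h ψ.1⟫_ℝ =
      -R * ⟪funToL2 h φ.1, funToL2 h ψ.1⟫_ℝ := by
    rw [real_inner_smul_left, real_inner_smul_right, ← mul_assoc, hs]
  rw [pairGradient, inner_hilbertProd, inner_hilbertProd, inner_hilbertProd]
  simp only [LinearMap.comp_apply, LinearMap.smul_apply, LinearMap.sub_apply, LinearMap.fst_apply,
    LinearMap.snd_apply]
  rw [h1]
  ring

/-- Expanding (⟨db, dV⟩ - λv, ⟨dc, dV⟩ - λw) produces the λ² term and two cross terms. One is the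
coupling in the first component of L; the other becomes the divergence term in the second after
`inner_curl` moves the derivative from c to v. -/
theorem inner_linearization_eq {R : ℝ} (hR : R ≤ 0) (lam : ℝ) (φ ψ : Func M × OneForm M) :
    ⟪pairToL2 h (linearization dV R lam φ), pairToL2 h ψ⟫_ℝ =
      -⟪pairGradient dV R lam φ, pairGradient dV R lam ψ⟫_ℝ := by
  obtain ⟨v, b⟩ := φ
  obtain ⟨w, c⟩ := ψ
  have h1 : laplacian dV v = -codiff dV (diff v) := rfl
  have h2 : divTwo dV v = -codiffTwo dV v := rfl
  have h3 := inner_curl dV c v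
  rw [real_inner_comm, real_inner_comm (formToL2 h (codiffTwo dV v))] at h3
  rw [inner_pairToL2, inner_pairGradient dV hR, linearization_apply, h1, h2]
  simp only [map_add, map_sub, map_smul, map_neg, inner_add_left, inner_sub_left, inner_neg_left,
    real_inner_smul_left, inner_sub_right, real_inner_smul_right, inner_codiff dV (diff v),
    inner_hodgeLaplacian, ← h3, smul_neg]
  ring

theorem tendsto_pairToL2 {u : ℕ → Func M × OneForm M} {x : L2Pair h} :
    Filter.Tendsto (fun n => pairToL2 h (u n)) Filter.atTop (𝓝 x) ↔
      Filter.Tendsto (fun n => funToL2 h (u n).1) Filter.atTop (𝓝 x.fst) ∧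
      Filter.Tendsto (fun n => formToL2 h (u n).2) Filter.atTop (𝓝 x.snd) :=
  tendsto_toLp

theorem mem_sobolev_form_iff (x : L2Form h) : x ∈ sobolev (formToL2 h) (firstOrderForm dV) ↔
    ∃ y, WithLp.toLp 2 (x, y) ∈ graphClosure (formToL2 h) (formGradient dV) := by
  constructor
  · intro hx
    obtain ⟨y, u, h1, h2⟩ := exists_seq_of_mem_sobolev hx
    -- The two first order operators list d*b and ⟨db, dV⟩ in opposite orders.
    refine ⟨WithLp.toLp 2 (y.2, y.1), mem_graphClosure_of_seq h1 (tendsto_toLp.2 ⟨?_, ?_⟩)⟩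
    · exact (continuous_snd.tendsto _).comp h2
    · exact (continuous_fst.tendsto _).comp h2
  · rintro ⟨y, hy⟩
    obtain ⟨u, h1, h2⟩ := exists_seq_of_mem_graphClosure hy
    exact mem_sobolev_of_seq (D := firstOrderForm dV) h1
      ((tendsto_toLp.1 h2).2.prodMk_nhds (tendsto_toLp.1 h2).1)

/-- The extra terms √(-R) v and -λv are bounded in v, so they converge whenever v does and do not
change the domain of the closure. -/
theorem mem_sobolev_pair_iff (R lam : ℝ) (x : L2Pair h) :
    x ∈ sobolev (pairToL2 h) (firstOrderPair dV) ↔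
      ∃ y, WithLp.toLp 2 (x, y) ∈ graphClosure (pairToL2 h) (pairGradient dV R lam) := by
  constructor
  · intro hx
    obtain ⟨y, u, h1, h2⟩ := exists_seq_of_mem_sobolev hx
    have hv := (tendsto_pairToL2.1 h1).1
    refine ⟨WithLp.toLp 2 (y.1, WithLp.toLp 2 (√(-R) • x.fst,
      WithLp.toLp 2 (y.2.2, y.2.1 - lam • x.fst))), mem_graphClosure_of_seq h1
        (tendsto_toLp.2 ⟨?_, tendsto_toLp.2 ⟨?_, tendsto_toLp.2 ⟨?_, ?_⟩⟩⟩)⟩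
    · exact (continuous_fst.tendsto y).comp h2
    · exact hv.const_smul _
    · exact ((continuous_snd.comp continuous_snd).tendsto _).comp h2
    · exact (((continuous_fst.comp continuous_snd).tendsto _).comp h2).sub (hv.const_smul lam)
  · rintro ⟨y, hy⟩
    obtain ⟨u, h1, h2⟩ := exists_seq_of_mem_graphClosure hy
    have hv := (tendsto_pairToL2.1 h1).1
    obtain ⟨h3, h4⟩ := tendsto_toLp.1 h2
    obtain ⟨-, h5⟩ := tendsto_toLp.1 h4
    obtain ⟨h6, h7⟩ := tendsto_toLp.1 h5
    refine mem_sobolev_of_seq (D := firstOrderPair dV) h1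
      (h3.prodMk_nhds (((h7.add (hv.const_smul lam)).congr fun n => ?_).prodMk_nhds h6))
    exact sub_add_cancel (funToL2 h (curl dV (u n).2)) (lam • funToL2 h (u n).1)

theorem isHarmonicL2_iff (b : L2Form h) : IsHarmonicL2 dV b ↔
    WithLp.toLp 2 (b, (0 : WithLp 2 (Lp ℝ 2 (area h) × Lp ℝ 2 (area h)))) ∈
      graphClosure (formToL2 h) (formGradient dV) :=
  mem_zeroEigenspace_realization (denseRange_formToL2 h) (inner_hodgeLaplacian_eq dV)
    (mem_sobolev_form_iff dV)

theorem mem_zeroEigenspace_linearizedL2 {R : ℝ} (hR : R ≤ 0) {lam : ℝ} (hlam : lam ≠ 0)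
    (x : L2Pair h) : x ∈ zeroEigenspace (linearizedL2 dV R lam) ↔
      x.fst = 0 ∧ IsHarmonicL2 dV x.snd := by
  rw [isHarmonicL2_iff]
  refine (mem_zeroEigenspace_realization (denseRange_pairToL2 h) (inner_linearization_eq dV hR lam)
    (mem_sobolev_pair_iff dV R lam)).trans ⟨fun hx => ?_, ?_⟩
  · obtain ⟨u, h1, h2⟩ := exists_seq_of_mem_graphClosure hx
    obtain ⟨hv, hb⟩ := tendsto_pairToL2.1 h1
    obtain ⟨h3, h4⟩ := tendsto_toLp.1 h2
    obtain ⟨-, h5⟩ := tendsto_toLp.1 h4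
    obtain ⟨h6, h7⟩ := tendsto_toLp.1 h5
    have hdv : Filter.Tendsto (fun n => formToL2 h (diff (u n).1)) Filter.atTop (𝓝 0) := h3
    have hcurl : Filter.Tendsto (fun n => funToL2 h (curl dV (u n).2)) Filter.atTop
        (𝓝 (lam • x.fst)) := by
      have h8 := h7.add (hv.const_smul lam)
      have h9 : (0 : WithLp 2 (L2Form h × WithLp 2 (Lp ℝ 2 (area h) ×
        WithLp 2 (Lp ℝ 2 (area h) × Lp ℝ 2 (area h))))).snd.snd.snd + lam • x.fst =
          lam • x.fst := zero_add _
      rw [h9] at h8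
      exact h8.congr fun n =>
        sub_add_cancel (funToL2 h (curl dV (u n).2)) (lam • funToL2 h (u n).1)
    -- The Hodge star is a pointwise isometry, so d*(vₙ dV) = -⋆dvₙ has the same norm as dvₙ.
    have hstar : Filter.Tendsto (fun n => formToL2 h (codiffTwo dV (u n).1)) Filter.atTop
        (𝓝 0) := by
      rw [tendsto_zero_iff_norm_tendsto_zero] at hdv ⊢
      refine hdv.congr fun n => ?_
      have h8 : codiffTwo dV (u n).1 = -hodgeStar dV (diff (u n).1) := rfl
      rw [h8, map_neg, norm_neg, norm_eq_sqrt_real_inner, norm_eq_sqrt_real_inner,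
        inner_formToL2, inner_formToL2]
      simp only [formInner_hodgeStar]
    -- The limit of (⟨dbₙ, dV⟩, vₙ) = (bₙ, d*(vₙ dV)) reads λ‖v‖² = 0.
    have hlim := tendsto_nhds_unique (hcurl.inner hv)
      ((hb.inner hstar).congr fun n => (inner_curl dV (u n).2 (u n).1).symm)
    rw [real_inner_smul_left, inner_zero_right] at hlim
    have hx0 : x.fst = 0 := inner_self_eq_zero.1 ((mul_eq_zero.1 hlim).resolve_left hlam)
    refine ⟨hx0, mem_graphClosure_of_seq hb (tendsto_toLp.2 ⟨h6, ?_⟩)⟩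
    rw [hx0, smul_zero] at hcurl
    exact hcurl
  · rintro ⟨hx0, hb⟩
    obtain ⟨u, h1, h2⟩ := exists_seq_of_mem_graphClosure hb
    obtain ⟨h3, h4⟩ := tendsto_toLp.1 h2
    refine mem_graphClosure_of_seq (u := fun n => ((0 : Func M), u n))
      (tendsto_pairToL2.2 ⟨?_, h1⟩)
      (tendsto_toLp.2 ⟨?_, tendsto_toLp.2 ⟨?_, tendsto_toLp.2 ⟨h3, ?_⟩⟩⟩)
    · simp only [map_zero, hx0]
      exact tendsto_const_nhds
    · refine tendsto_const_nhds.congr fun n => ?_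
      change 0 = formToL2 h (diff (0 : Func M))
      rw [map_zero, map_zero]
    · refine tendsto_const_nhds.congr fun n => ?_
      change 0 = √(-R) • funToL2 h (0 : Func M)
      rw [map_zero, smul_zero]
    · refine h4.congr fun n => ?_
      change funToL2 h (curl dV (u n)) = funToL2 h (curl dV (u n)) - lam • funToL2 h (0 : Func M)
      rw [map_zero, smul_zero, sub_zero]

/-- The L² statement gives v = 0 because smooth functions embed injectively in L², and the second
component then reduces to Δ_d b. Conversely a smooth harmonic form must be shown closed to kill the
coupling term λ⟨db, dV⟩. -/
theorem linearization_eq_zero_iff {R : ℝ} (hR : R ≤ 0) {lam : ℝ} (hlam : lam ≠ 0) (v : Func M)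
    (b : OneForm M) : linearization dV R lam (v, b) = 0 ↔ v = 0 ∧ hodgeLaplacian dV b = 0 := by
  constructor
  · intro h0
    have hv : v = 0 := by
      have h2 : pairToL2 h (v, b) ∈ zeroEigenspace (linearizedL2 dV R lam) := by
        obtain ⟨hp, hL⟩ := realization_apply_smooth (denseRange_pairToL2 h)
          (inner_linearization_eq dV hR lam) (mem_sobolev_pair_iff dV R lam) (v, b)
        exact ⟨hp, by rw [h0, map_zero] at hL; exact hL⟩
      have h3 := ((mem_zeroEigenspace_linearizedL2 dV hR hlam _).1 h2).1
      have h4 : funToL2 h v = funToL2 h 0 := by rw [map_zero]; exact h3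
      exact funToL2_injective dV h4
    subst hv
    refine ⟨rfl, ?_⟩
    have h1 := congrArg Prod.snd h0
    rw [linearization_apply] at h1
    simpa using h1
  · rintro ⟨rfl, hb⟩
    have h1 : hodgeLaplacian dV b = 0 := hb
    -- Pairing Δ_d b = 0 with b gives ‖d*b‖² + ‖⟨db, dV⟩‖² = 0.
    have h2 : curl dV b = 0 := by
      have h3 := inner_hodgeLaplacian dV b b
      rw [h1, map_zero, inner_zero_left] at h3
      have h4 := real_inner_self_nonneg (x := funToL2 h (codiff dV b))
      have h5 := real_inner_self_nonneg (x := funToL2 h (curl dV b))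
      have h6 : funToL2 h (curl dV b) = funToL2 h 0 := by
        rw [map_zero]
        exact inner_self_eq_zero.1 (by linarith : ⟪funToL2 h (curl dV b), funToL2 h (curl dV b)⟫_ℝ = 0)
      exact funToL2_injective dV h6
    rw [linearization_apply, h1, h2]
    simp

end Main

end Surface
end

/-! ### The theorem, assembled from the Friedrichs resolvent and the kernel computation. -/

theorem mainTheorem4 {M : Type*} [TopologicalSpace M] [ChartedSpace Plane M]
    [IsManifold (𝓡 2) ∞ M] [CompactSpace M] [T2Space M] [MeasurableSpace M] [BorelSpace M]
    (h : Surface.Metric M) (dV : Surface.AreaForm h) (R lam : ℝ)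
    (hR : ∀ q : M, Surface.scalarCurvature h q = R) (hR_nonpos : R ≤ 0) (hlam : lam ≠ 0) :
    -- `L` is a self-adjoint operator
    IsSelfAdjoint (Surface.linearizedL2 dV R lam) ∧
    -- `L` is given on smooth pairs by the classical expression
    (∀ p : Surface.Func M × Surface.OneForm M,
      ∃ hp : Surface.pairToL2 h p ∈ (Surface.linearizedL2 dV R lam).domain,
        Surface.linearizedL2 dV R lam ⟨Surface.pairToL2 h p, hp⟩ =
          Surface.pairToL2 h (Surface.linearization dV R lam p)) ∧
    -- the spectrum of `L` is contained in `(-∞, 0]`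
    Surface.spectrum (Surface.linearizedL2 dV R lam) ⊆ {μ : ℂ | μ.im = 0 ∧ μ.re ≤ 0} ∧
    -- the zero eigenspace of `L` consists of the pairs `(0, b)` with `b` harmonic
    Surface.zeroEigenspace (Surface.linearizedL2 dV R lam) =
      {u : Surface.L2Pair h | u.fst = 0 ∧ Surface.IsHarmonicL2 dV u.snd} ∧
    -- the same for smooth pairs
    (∀ (v : Surface.Func M) (b : Surface.OneForm M),
      Surface.linearization dV R lam (v, b) = 0 ↔ v = 0 ∧ Surface.hodgeLaplacian dV b = 0) := by
  have hK := Surface.isContractiveResolvent_realization (Surface.denseRange_pairToL2 h)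
    (Surface.inner_linearization_eq dV hR_nonpos lam) (Surface.mem_sobolev_pair_iff dV R lam)
  exact ⟨hK.isSelfAdjoint,
    Surface.realization_apply_smooth (Surface.denseRange_pairToL2 h)
      (Surface.inner_linearization_eq dV hR_nonpos lam) (Surface.mem_sobolev_pair_iff dV R lam),
    hK.spectrum_subset,
    Set.ext fun x => Surface.mem_zeroEigenspace_linearizedL2 dV hR_nonpos hlam x,
    Surface.linearization_eq_zero_iff dV hR_nonpos hlam⟩
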